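/- **Setting.** Let $1\le d\le p$ be integers. Write $|\cdot|_d$ (and $dx$) for $d$-dimensional Hausdorff measure in $\mathbb R^p$, normalized so that the unit cube of $\mathbb R^d\subset\mathbb R^p$ has measure $1$. Let $\Omega\subset\mathbb R^p$ be compact with $0<|\Omega|_d<\infty$, and a smooth $d$-dimensional embedded submanifold of $\mathbb R^p$, possibly with boundary. Topological notions below are relative to $\Omega$. *Regular basis.* Balls are balls of $\mathbb R^p$. For $X\subset\mathbb R^p$ let $P_d(X)=\lim_{\delta\to0^+}\sup\sum_i(\operatorname{diam}B_i)^d$, the supremum over finite or countable families of pairwise disjoint closed balls with centers in $X$ and diameter at most $\delta$, and let $h_d(X)=\lim_{\delta\to0^+}\inf\sum_j(\operatorname{diam}B_j)^d$, the infimum over countable covers of $X$ by open balls of diameter less than $\delta$. Assume that the topology of $\Omega$ has a basis of open sets $U$ with $h_d(\partial U)=P_d(\partial U)=0$ and $P_d(U)=h_d(U)$. *Euclidean type.* Let $\beta_d=\pi^{d/2}/\Gamma(d/2+1)$. Let $\Delta_d$ be the supremum, over sequences of non-overlapping closed unit balls $S_j$ in $\mathbb R^d$ for which the limit exists, of $\lim_{t\to\infty}(2t)^{-d}\sum_j|S_j\cap[-t,t]^d|_d$,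 and let $\Theta_d$ be the infimum of the same limit (when it exists) over sequences of closed unit balls whose union is $\mathbb R^d$. Let $Q_d(X)=\limsup_{\delta\to0^+}\sup N\beta_d\delta^d$, the supremum over families of $N$ pairwise disjoint closed balls of radius $\delta$ with centers in $X$, and $C_d(X)=\liminf_{\delta\to0^+}\inf N\beta_d\delta^d$, the infimum over covers of $X$ by $N$ closed balls of radius $\delta$ with centers in $X$. Assume that $\Omega$ is of Euclidean type: every open $U\subseteq\Omega$ with $|U|_d=|\overline U|_d$ satisfies $Q_d(U)=Q_d(\overline U)=|U|_d\Delta_d$ and $C_d(U)=C_d(\overline U)=|U|_d\Theta_d$. *Kernel.* Let $k(x,y)=f(|x-y|)$, where $f$ is completely monotone on $(0,\infty)$ (smooth, with $(-1)^\ell f^{(\ell)}\ge0$ on $(0,\infty)$ for all $\ell\ge0$), $k(x,y)>0$ for $x\ne y$ in $\Omega$, and $k$ is integrable on $\Omega\times\Omega$. *Discrete problem.* Fix $r,R>0$. For $n\ge1$, an $n$-point configuration $X_n=\{x_j\}_{j=1}^n\subset\Omega$ is admissible if $|x_i-x_j|\ge rn^{-1/d}$ for all $i\ne j$ and every $y\in\Omega$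 is within distance $Rn^{-1/d}$ of some $x_j$. It is optimal if it is admissible and maximizes $\frac1{2n^2}\sum_{i\ne j}k(x_i,x_j)$ among admissible $n$-point configurations. Its empirical measure is $\nu_n=\frac1n\sum_{j=1}^n\delta_{x_j}$. *Continuous problem.* Fix $\rho_+\ge|\Omega|_d^{-1}\ge\rho_->0$. A density $\rho\in L^\infty(\Omega)$ is admissible if $\int_\Omega\rho\,dx=1$ and $\rho_-\le\rho\le\rho_+$ a.e. It is extremal if it is admissible and maximizes $E[\rho]=\frac12\int_{\Omega\times\Omega}k(x,y)\rho(x)\rho(y)\,dx\,dy$ among admissible densities. **Corollary 4.3.** In this setting, assume that $\rho_+r^d\beta_d\ge2^d\Delta_d$ and $\rho_-R^d\beta_d\le\Theta_d$, and that there is a constant $C_0$ such that $$\frac{f(x)}{f(x+\sqrt2\,Rn^{-1/d})}\le C_0\qquad\text{for all integers }n\ge1\text{ and all }x\ge rn^{-1/d}.$$ Assume further that there are admissible $n$-point configurations $X_n'$, $n\ge2$, whose empirical measures converge weak-$*$ to a measure $\rho^\star\,dx$ with $\rho^\star$ extremal. For each $n\ge2$ let $X_n^*$ be an optimal $n$-point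 configuration, with empirical measure $\nu_n^*$. Then every weak-$*$ limit of $\{\nu_n^*\}_{n\ge2}$ (the limit of a weak-$*$ convergent subsequence) is of the form $\rho\,dx$ with $\rho$ an extremal density. -/

import Mathlib

open Set Filter Topology MeasureTheory
open scoped ENNReal ContDiff

noncomputable section

namespace PointConfig

/-! ### Measures and volume constants -/

/-- The restriction to `Ω ⊆ ℝ^p` of the `d`-dimensional Hausdorff measure, normalized so that the
unit cube of `ℝ^d ⊆ ℝ^p` has measure one. -/
def surf {p : ℕ} (d : ℕ) (Ω : Set (EuclideanSpace ℝ (Fin p))) :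
    Measure (EuclideanSpace ℝ (Fin p)) :=
  (Measure.euclideanHausdorffMeasure d).restrict Ω

/-- The volume of the unit ball of `ℝ^d`. -/
def ballVol (d : ℕ) : ℝ :=
  Real.pi ^ ((d : ℝ) / 2) / Real.Gamma ((d : ℝ) / 2 + 1)

/-- `D` is the density of the family of unit balls of `ℝ^d` with centers `c j`: the limit as
`t → ∞` of `(2t)^{-d} ∑ⱼ |Sⱼ ∩ [-t,t]^d|`. -/
def HasBallDensity (d : ℕ) (c : ℕ → EuclideanSpace ℝ (Fin d)) (D : ℝ≥0∞) : Prop :=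
  Tendsto (fun t : ℝ =>
      (∑' j, volume (Metric.closedBall (c j) 1 ∩ {x | ∀ i, x i ∈ Icc (-t) t})) /
        ENNReal.ofReal ((2 * t) ^ d))
    atTop (𝓝 D)

/-- The upper packing density of `ℝ^d`; non-overlapping means with disjoint interiors. -/
def packingDensity (d : ℕ) : ℝ≥0∞ :=
  sSup {D | ∃ c : ℕ → EuclideanSpace ℝ (Fin d),
    (Pairwise fun i j => Disjoint (Metric.ball (c i) 1) (Metric.ball (c j) 1)) ∧
    HasBallDensity d c D}

/-- The lower covering density of `ℝ^d`. -/
def coveringDensity (d : ℕ) : ℝ≥0∞ :=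
  sInf {D | ∃ c : ℕ → EuclideanSpace ℝ (Fin d),
    (⋃ j, Metric.closedBall (c j) 1) = univ ∧ HasBallDensity d c D}

/-! ### Packing premeasure and (spherical) Hausdorff outer measure, normalized by `diam^d` -/

/-- Supremum of `∑ (diam Bᵢ)^d` over finite or countable families of disjoint closed balls
centered in `X` with diameters at most `δ`; the families are indexed by subsets `I` of `ℕ`, and
the ball of radius `s i` has diameter `2 * s i`. -/
def packPre {p : ℕ} (d : ℕ) (X : Set (EuclideanSpace ℝ (Fin p))) (δ : ℝ) : ℝ≥0∞ :=
  sSup {S | ∃ (I : Set ℕ) (c : ℕ → EuclideanSpace ℝ (Fin p)) (s : ℕ → ℝ),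
    (∀ i ∈ I, c i ∈ X ∧ 0 < s i ∧ 2 * s i ≤ δ) ∧
    I.PairwiseDisjoint (fun i => Metric.closedBall (c i) (s i)) ∧
    S = ∑' i : I, ENNReal.ofReal ((2 * s i) ^ d)}

/-- The `d`-dimensional packing premeasure: the limit of `packPre d X δ` as `δ → 0+`, which by
monotonicity is an infimum. -/
def packingPremeasure {p : ℕ} (d : ℕ) (X : Set (EuclideanSpace ℝ (Fin p))) : ℝ≥0∞ :=
  ⨅ (δ : ℝ) (_ : 0 < δ), packPre d X δ

/-- Infimum of `∑ (diam Bⱼ)^d` over countable covers of `X` by open balls of diameter `< δ`. -/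
def hausPre {p : ℕ} (d : ℕ) (X : Set (EuclideanSpace ℝ (Fin p))) (δ : ℝ) : ℝ≥0∞ :=
  sInf {S | ∃ (I : Set ℕ) (c : ℕ → EuclideanSpace ℝ (Fin p)) (s : ℕ → ℝ),
    (∀ i ∈ I, 0 < s i ∧ 2 * s i < δ) ∧
    X ⊆ ⋃ i ∈ I, Metric.ball (c i) (s i) ∧
    S = ∑' i : I, ENNReal.ofReal ((2 * s i) ^ d)}

/-- The `d`-dimensional Hausdorff outer measure built from balls: the limit of `hausPre d X δ` as
`δ → 0+`, which by monotonicity is a supremum. -/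
def ballHausdorff {p : ℕ} (d : ℕ) (X : Set (EuclideanSpace ℝ (Fin p))) : ℝ≥0∞ :=
  ⨆ (δ : ℝ) (_ : 0 < δ), hausPre d X δ

/-- The topology of `Ω` has a basis of open sets `U` whose boundary in `Ω` is null for both set
functions above, and on which the two set functions agree. -/
def HasRegularBasis {p : ℕ} (d : ℕ) (Ω : Set (EuclideanSpace ℝ (Fin p))) : Prop :=
  ∃ B : Set (Set Ω), TopologicalSpace.IsTopologicalBasis B ∧
    ∀ U ∈ B,
      ballHausdorff d ((↑) '' frontier U : Set (EuclideanSpace ℝ (Fin p))) = 0 ∧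
      packingPremeasure d ((↑) '' frontier U : Set (EuclideanSpace ℝ (Fin p))) = 0 ∧
      packingPremeasure d ((↑) '' U : Set (EuclideanSpace ℝ (Fin p))) =
        ballHausdorff d ((↑) '' U : Set (EuclideanSpace ℝ (Fin p)))

/-! ### Sets of Euclidean type -/

/-- Supremum of `N β_d δ^d` over families of `N` disjoint closed balls of radius `δ` centered
in `X`. -/
def packAt {p : ℕ} (d : ℕ) (X : Set (EuclideanSpace ℝ (Fin p))) (δ : ℝ) : ℝ≥0∞ :=
  sSup {S | ∃ (N : ℕ) (c : Fin N → EuclideanSpace ℝ (Fin p)), (∀ i, c i ∈ X) ∧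
    (Pairwise fun i j => Disjoint (Metric.closedBall (c i) δ) (Metric.closedBall (c j) δ)) ∧
    S = ENNReal.ofReal (N * ballVol d * δ ^ d)}

/-- Infimum of `N β_d δ^d` over covers of `X` by `N` closed balls of radius `δ` centered
in `X`. -/
def coverAt {p : ℕ} (d : ℕ) (X : Set (EuclideanSpace ℝ (Fin p))) (δ : ℝ) : ℝ≥0∞ :=
  sInf {S | ∃ (N : ℕ) (c : Fin N → EuclideanSpace ℝ (Fin p)), (∀ i, c i ∈ X) ∧
    X ⊆ ⋃ i, Metric.closedBall (c i) δ ∧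
    S = ENNReal.ofReal (N * ballVol d * δ ^ d)}

/-- `Q_d(X)`. -/
def packLim {p : ℕ} (d : ℕ) (X : Set (EuclideanSpace ℝ (Fin p))) : ℝ≥0∞ :=
  limsup (fun δ : ℝ => packAt d X δ) (𝓝[>] 0)

/-- `C_d(X)`. -/
def coverLim {p : ℕ} (d : ℕ) (X : Set (EuclideanSpace ℝ (Fin p))) : ℝ≥0∞ :=
  liminf (fun δ : ℝ => coverAt d X δ) (𝓝[>] 0)

/-- `Ω` is of Euclidean type: for every `U` open in `Ω` with `|U|_d = |closure U|_d`,
`Q_d(U) = Q_d(closure U) = |U|_d Δ_d` and `C_d(U) = C_d(closure U) = |U|_d Θ_d`. -/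
def IsEuclideanType {p : ℕ} (d : ℕ) (Ω : Set (EuclideanSpace ℝ (Fin p))) : Prop :=
  ∀ U : Set Ω, IsOpen U →
    surf d Ω ((↑) '' U) = surf d Ω ((↑) '' closure U) →
      packLim d ((↑) '' U : Set (EuclideanSpace ℝ (Fin p))) =
        surf d Ω ((↑) '' U) * packingDensity d ∧
      packLim d ((↑) '' closure U : Set (EuclideanSpace ℝ (Fin p))) =
        surf d Ω ((↑) '' U) * packingDensity d ∧
      coverLim d ((↑) '' U : Set (EuclideanSpace ℝ (Fin p))) =
        surf d Ω ((↑) '' U) * coveringDensity d ∧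
      coverLim d ((↑) '' closure U : Set (EuclideanSpace ℝ (Fin p))) =
        surf d Ω ((↑) '' U) * coveringDensity d

/-! ### Smooth submanifolds of `ℝ^p` -/

/-- The coordinate subspace `ℝ^d × {0}` of `ℝ^p`. -/
def flatModel (p d : ℕ) : Set (EuclideanSpace ℝ (Fin p)) :=
  {z | ∀ i : Fin p, d ≤ (i : ℕ) → z i = 0}

/-- The half space of `ℝ^d × {0}` on which the first coordinate is nonnegative. -/
def halfModel (p d : ℕ) : Set (EuclideanSpace ℝ (Fin p)) :=
  {z | z ∈ flatModel p d ∧ ∀ i : Fin p, (i : ℕ) = 0 → 0 ≤ z i}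

/-- `Ω` is a smooth `d`-dimensional (embedded) submanifold of `ℝ^p`, possibly with boundary:
near each of its points a smooth diffeomorphism between open subsets of `ℝ^p` straightens `Ω` to
`ℝ^d × {0}` or to a half space of it. -/
def IsSmoothSubmanifold {p : ℕ} (d : ℕ) (Ω : Set (EuclideanSpace ℝ (Fin p))) : Prop :=
  ∀ x ∈ Ω, ∃ e : OpenPartialHomeomorph (EuclideanSpace ℝ (Fin p)) (EuclideanSpace ℝ (Fin p)),
    x ∈ e.source ∧ ContDiffOn ℝ ∞ e e.source ∧ ContDiffOn ℝ ∞ e.symm e.target ∧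
    (e.IsImage Ω (flatModel p d) ∨ e.IsImage Ω (halfModel p d))

/-! ### The kernel -/

/-- Complete monotonicity on `(0,∞)`. -/
def IsCompletelyMonotone (f : ℝ → ℝ) : Prop :=
  ContDiffOn ℝ ∞ f (Ioi 0) ∧
    ∀ (l : ℕ) (t : ℝ), 0 < t → 0 ≤ (-1) ^ l * iteratedDerivWithin l f (Ioi 0) t

/-! ### The discrete problem -/

/-- The two constraints of the discrete problem for an `n`-point configuration in `Ω`. -/
def IsAdmissible {p : ℕ} (d : ℕ) (Ω : Set (EuclideanSpace ℝ (Fin p))) (r R : ℝ) (n : ℕ)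
    (X : Fin n → EuclideanSpace ℝ (Fin p)) : Prop :=
  (∀ i, X i ∈ Ω) ∧
  (∀ i j, i ≠ j → r * (n : ℝ) ^ (-(1 : ℝ) / d) ≤ dist (X i) (X j)) ∧
  (∀ y ∈ Ω, ∃ i, dist (X i) y ≤ R * (n : ℝ) ^ (-(1 : ℝ) / d))

/-- The objective `(2n²)⁻¹ ∑_{i ≠ j} k(x_i, x_j)` with `k(x,y) = f(|x-y|)`. -/
def discreteEnergy {p : ℕ} (f : ℝ → ℝ) (n : ℕ) (X : Fin n → EuclideanSpace ℝ (Fin p)) : ℝ :=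
  1 / (2 * (n : ℝ) ^ 2) * ∑ q ∈ Finset.univ.offDiag, f (dist (X q.1) (X q.2))

/-- `X` attains the maximum in the discrete problem. -/
def IsOptimalConfig {p : ℕ} (d : ℕ) (Ω : Set (EuclideanSpace ℝ (Fin p))) (r R : ℝ) (f : ℝ → ℝ)
    (n : ℕ) (X : Fin n → EuclideanSpace ℝ (Fin p)) : Prop :=
  IsAdmissible d Ω r R n X ∧
    ∀ Y : Fin n → EuclideanSpace ℝ (Fin p), IsAdmissible d Ω r R n Y →
      discreteEnergy f n Y ≤ discreteEnergy f n X

/-- The empirical measure `n⁻¹ ∑ⱼ δ_{xⱼ}` (the zero measure if `n = 0`). The topology of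
`FiniteMeasure` is that of weak-* convergence against bounded continuous functions. -/
def empirical {p : ℕ} (n : ℕ) (X : Fin n → EuclideanSpace ℝ (Fin p)) :
    FiniteMeasure (EuclideanSpace ℝ (Fin p)) :=
  ⟨(n : ℝ≥0∞)⁻¹ • ∑ j, Measure.dirac (X j), by
    rcases Nat.eq_zero_or_pos n with h | h
    · subst h
      simp only [Finset.univ_eq_empty, Finset.sum_empty, smul_zero]
      infer_instance
    · refine ⟨?_⟩
      simp only [Measure.smul_apply, Measure.finsetSum_apply, measure_univ, Finset.sum_const,
        Finset.card_univ, Fintype.card_fin, nsmul_eq_mul, mul_one, smul_eq_mul]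
      exact ENNReal.mul_lt_top (ENNReal.inv_lt_top.2 (by exact_mod_cast h))
        (ENNReal.natCast_lt_top n)⟩

/-! ### The continuous problem -/

/-- `E[ρ] = ½ ∫∫ k(x,y) ρ(x) ρ(y) dx dy` with `k(x,y) = f(|x-y|)`. -/
def densityEnergy {p : ℕ} (d : ℕ) (Ω : Set (EuclideanSpace ℝ (Fin p))) (f : ℝ → ℝ)
    (ρ : EuclideanSpace ℝ (Fin p) → ℝ) : ℝ :=
  1 / 2 * ∫ q, f (dist q.1 q.2) * ρ q.1 * ρ q.2 ∂((surf d Ω).prod (surf d Ω))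

/-- The admissible class `A(Ω, ρ₊, ρ₋)`. -/
def IsAdmissibleDensity {p : ℕ} (d : ℕ) (Ω : Set (EuclideanSpace ℝ (Fin p)))
    (ρplus ρminus : ℝ) (ρ : EuclideanSpace ℝ (Fin p) → ℝ) : Prop :=
  MemLp ρ ⊤ (surf d Ω) ∧ ∫ x, ρ x ∂(surf d Ω) = 1 ∧
    ∀ᵐ x ∂(surf d Ω), ρminus ≤ ρ x ∧ ρ x ≤ ρplus

/-- `ρ` attains the supremum in the continuous problem. -/
def IsExtremalDensity {p : ℕ} (d : ℕ) (Ω : Set (EuclideanSpace ℝ (Fin p))) (f : ℝ → ℝ)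
    (ρplus ρminus : ℝ) (ρ : EuclideanSpace ℝ (Fin p) → ℝ) : Prop :=
  IsAdmissibleDensity d Ω ρplus ρminus ρ ∧
    ∀ σ : EuclideanSpace ℝ (Fin p) → ℝ, IsAdmissibleDensity d Ω ρplus ρminus σ →
      densityEnergy d Ω f σ ≤ densityEnergy d Ω f ρ

/-- The measure `ν` is concentrated on `Ω` with density `ρ` with respect to `d`-dimensional
Hausdorff measure on `Ω`. -/
def HasDensity {p : ℕ} (d : ℕ) (Ω : Set (EuclideanSpace ℝ (Fin p)))
    (ν : FiniteMeasure (EuclideanSpace ℝ (Fin p))) (ρ : EuclideanSpace ℝ (Fin p) → ℝ) : Prop :=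
  (ν : Measure (EuclideanSpace ℝ (Fin p))) =
    (surf d Ω).withDensity fun x => ENNReal.ofReal (ρ x)

end PointConfig

end

/-! Any weak-* limit `ν` of empirical measures of admissible configurations has a density between
`ρminus` and `ρplus`. Let `V` be open with null frontier. Separation makes the points in `V` centers
of disjoint balls of radius just below r n^(-1/d)/2, so the Euclidean-type packing limit bounds `ν
V` from above (`limit_open_le`). Dually, balls of radius R n^(-1/d) about the points in `V` cover `V
∩ Ω` except near the frontier, so the covering limit bounds `ν (closure V)` from below
(`le_limit_closure`). Regularity and Radon–Nikodym turn these bounds into a density.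

It remains to compare energies, the difficulty being the singularity of the kernel on the diagonal.
The kernel truncated at distance ε is bounded and continuous, so its discrete energies converge to
the energy of the limit. For the competitors X', truncation only lowers the off-diagonal energy, and
the added diagonal terms vanish in the limit. For the optimal configurations an upper bound on the
discarded pairs is needed: around each pair closer than ε, spread its mass over a product of two
small balls. These products are disjoint, have measure at least a multiple of n^(-2), and the ratio
condition on f makes the kernel on them comparable to its value at the pair. The discarded energy is
thus at most a constant times the integral of k over a strip about the diagonal, uniformly in n
(`sum_near_diagonal_le`). Let n → ∞, then ε → 0: the limit of the optimal configurations has at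
least the energy of `ρstar`, which is maximal.

Both the frontier correction and the near-diagonal bound rest on lower Ahlfors regularity,
surf(B(y,s)) ≥ c s^d for y in Ω (`exists_le_surf_ball`), which follows from compactness and smooth
charts. -/

namespace PointConfig

/-! ### Lower Ahlfors regularity of compact smooth submanifolds -/

/-- The inclusion of `ℝ^d` into `ℝ^p` as the first `d` coordinates. -/
def zeroExtend (d p : ℕ) (u : EuclideanSpace ℝ (Fin d)) : EuclideanSpace ℝ (Fin p) :=
  WithLp.toLp 2 fun i => if h : (i : ℕ) < d then u ⟨i, h⟩ else 0

theorem zeroExtend_apply_of_lt {d p : ℕ} (u : EuclideanSpace ℝ (Fin d)) {i : Fin p}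
    (h : (i : ℕ) < d) : zeroExtend d p u i = u ⟨i, h⟩ := by
  simp [zeroExtend, h]

theorem zeroExtend_apply_of_le {d p : ℕ} (u : EuclideanSpace ℝ (Fin d)) {i : Fin p}
    (h : d ≤ (i : ℕ)) : zeroExtend d p u i = 0 := by
  simp [zeroExtend, not_lt.2 h]

theorem isometry_zeroExtend {d p : ℕ} (hdp : d ≤ p) : Isometry (zeroExtend d p) := by
  obtain ⟨k, rfl⟩ := Nat.exists_eq_add_of_le hdp
  refine Isometry.of_dist_eq fun u v => ?_
  rw [EuclideanSpace.dist_eq, EuclideanSpace.dist_eq, Fin.sum_univ_add]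
  have h₁ : ∀ (w : EuclideanSpace ℝ (Fin d)) (i : Fin d),
      zeroExtend d (d + k) w (Fin.castAdd k i) = w i := fun w i =>
    zeroExtend_apply_of_lt w (i := Fin.castAdd k i) i.2
  have h₂ : ∀ (w : EuclideanSpace ℝ (Fin d)) (i : Fin k),
      zeroExtend d (d + k) w (Fin.natAdd d i) = 0 := fun w i =>
    zeroExtend_apply_of_le w (by simp)
  simp [h₁, h₂]

theorem mem_flatModel_zeroExtend (d p : ℕ) (u : EuclideanSpace ℝ (Fin d)) :
    zeroExtend d p u ∈ flatModel p d := fun _ hi => zeroExtend_apply_of_le u hi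

theorem exists_zeroExtend_eq {d p : ℕ} (hdp : d ≤ p) {z : EuclideanSpace ℝ (Fin p)}
    (hz : z ∈ flatModel p d) : ∃ u, zeroExtend d p u = z := by
  refine ⟨WithLp.toLp 2 fun i => z (Fin.castLE hdp i), ?_⟩
  ext i
  rcases lt_or_ge (i : ℕ) d with h | h
  · rw [zeroExtend_apply_of_lt _ h]; rfl
  · rw [zeroExtend_apply_of_le _ h, hz i h]

theorem abs_sub_apply_le_dist {p : ℕ} (x y : EuclideanSpace ℝ (Fin p)) (i : Fin p) :
    |x i - y i| ≤ dist x y := by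
  rw [dist_eq_norm]
  simpa using PiLp.norm_apply_le (p := 2) (x - y) i

/-- A ball of the half-space model contains the image of a `d`-dimensional ball of half the
radius; likewise for the flat model. -/
theorem exists_zeroExtend_ball_subset {p d : ℕ} (hd : 1 ≤ d) (hdp : d ≤ p)
    {M : Set (EuclideanSpace ℝ (Fin p))} (hM : M = flatModel p d ∨ M = halfModel p d)
    {z : EuclideanSpace ℝ (Fin p)} (hz : z ∈ M) {m : ℝ} (hm : 0 < m) :
    ∃ u, zeroExtend d p '' Metric.ball u (m / 2) ⊆ M ∩ Metric.ball z m := by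
  have hflat : z ∈ flatModel p d := by
    rcases hM with rfl | rfl
    exacts [hz, hz.1]
  let i₀ : Fin p := ⟨0, by omega⟩
  -- Moving inward by m/2 along the first coordinate makes the ball of radius m/2 stay in the half
  -- space even when z lies on its boundary.
  set z' : EuclideanSpace ℝ (Fin p) := z + EuclideanSpace.single i₀ (m / 2) with hz'
  have hflat' : z' ∈ flatModel p d := by
    intro i hi
    have : i ≠ i₀ := by rintro rfl; simp [i₀] at hi; omega
    simp [hz', hflat i hi, this]
  have hdist : dist z' z = m / 2 := by
    rw [dist_eq_norm]; simp [hz', abs_of_pos hm]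
  obtain ⟨u, hu⟩ := exists_zeroExtend_eq hdp hflat'
  refine ⟨u, ?_⟩
  rintro _ ⟨w, hw, rfl⟩
  have hwz : dist (zeroExtend d p w) z' < m / 2 := by
    rw [← hu, (isometry_zeroExtend hdp).dist_eq]; exact hw
  refine ⟨?_, ?_⟩
  · rcases hM with rfl | rfl
    · exact mem_flatModel_zeroExtend d p w
    · refine ⟨mem_flatModel_zeroExtend d p w, fun i hi => ?_⟩
      obtain rfl : i = i₀ := Fin.ext hi
      have h₁ := (abs_le.1 ((abs_sub_apply_le_dist (zeroExtend d p w) z' i₀))).1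
      have h₂ : z' i₀ = z i₀ + m / 2 := by simp [hz']
      have h₃ := hz.2 i₀ rfl
      linarith
  · rw [Metric.mem_ball]
    linarith [dist_triangle (zeroExtend d p w) z' z]

theorem euclideanHausdorffMeasure_image_le {p : ℕ} (d : ℕ) {K : NNReal}
    {g : EuclideanSpace ℝ (Fin p) → EuclideanSpace ℝ (Fin p)} {s : Set (EuclideanSpace ℝ (Fin p))}
    (hg : LipschitzOnWith K g s) :
    (Measure.euclideanHausdorffMeasure d) (g '' s) ≤
      (K : ℝ≥0∞) ^ d * (Measure.euclideanHausdorffMeasure d) s := by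
  have h := hg.hausdorffMeasure_image_le (d := d) (by positivity)
  rw [ENNReal.rpow_natCast] at h
  simp only [Measure.euclideanHausdorffMeasure_def, Measure.smul_apply, ENNReal.smul_def,
    smul_eq_mul]
  calc _ ≤ _ := mul_le_mul_right h _
    _ = _ := by ring

/-- The `d`-dimensional measure of balls centered in a model space. -/
theorem le_euclideanHausdorffMeasure_model {p d : ℕ} (hd : 1 ≤ d) (hdp : d ≤ p)
    {M : Set (EuclideanSpace ℝ (Fin p))} (hM : M = flatModel p d ∨ M = halfModel p d)
    {z : EuclideanSpace ℝ (Fin p)} (hz : z ∈ M) {m : ℝ} (hm : 0 < m) :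
    ENNReal.ofReal ((m / 2) ^ d) * volume (Metric.ball (0 : EuclideanSpace ℝ (Fin d)) 1) ≤
      (Measure.euclideanHausdorffMeasure d) (M ∩ Metric.ball z m) := by
  obtain ⟨u, hu⟩ := exists_zeroExtend_ball_subset hd hdp hM hz hm
  refine le_trans (le_of_eq ?_) (measure_mono hu)
  rw [(isometry_zeroExtend hdp).euclideanHausdorffMeasure_image,
    EuclideanSpace.euclideanHausdorffMeasure_eq_volume]
  have : Nonempty (Fin d) := ⟨⟨0, hd⟩⟩
  rw [Measure.addHaar_ball volume u (by positivity : 0 ≤ m / 2)]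
  simp

/-- A straightening chart is bi-Lipschitz near x. The inverse chart carries a model ball of radius
comparable to s into `Ω ∩ ball y s`, and the chart, being Lipschitz there, cannot increase
d-dimensional measure by more than a constant factor. The constants depend on x only, not on the
nearby center y. -/
theorem exists_nhds_le_measure_ball {p d : ℕ} (hd : 1 ≤ d) (hdp : d ≤ p)
    {Ω : Set (EuclideanSpace ℝ (Fin p))} (hΩ : IsSmoothSubmanifold d Ω)
    {x : EuclideanSpace ℝ (Fin p)} (hx : x ∈ Ω) :
    ∃ t ∈ 𝓝 x, ∃ c : ℝ, 0 < c ∧ ∃ s₀ : ℝ, 0 < s₀ ∧ ∀ y ∈ t, y ∈ Ω → ∀ s, 0 < s → s ≤ s₀ →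
      ENNReal.ofReal (c * s ^ d) ≤
        (Measure.euclideanHausdorffMeasure d) (Ω ∩ Metric.ball y s) := by
  obtain ⟨e, hxe, he, hes, hM⟩ := hΩ x hx
  obtain ⟨M, hM', him⟩ : ∃ M, (M = flatModel p d ∨ M = halfModel p d) ∧ e.IsImage Ω M := by
    rcases hM with h | h
    exacts [⟨_, Or.inl rfl, h⟩, ⟨_, Or.inr rfl, h⟩]
  have hex : e x ∈ e.target := e.map_source hxe
  obtain ⟨K, t, ht, hK⟩ := ContDiffAt.exists_lipschitzOnWith (𝕂 := ℝ)
    (((he.contDiffAt (e.open_source.mem_nhds hxe)).of_le (by exact_mod_cast le_top) :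
      ContDiffAt ℝ 1 e x))
  obtain ⟨K', t', ht', hK'⟩ := ContDiffAt.exists_lipschitzOnWith (𝕂 := ℝ)
    (((hes.contDiffAt (e.open_target.mem_nhds hex)).of_le (by exact_mod_cast le_top) :
      ContDiffAt ℝ 1 e.symm (e x)))
  have hpre : e.symm ⁻¹' t ∈ 𝓝 (e x) := by
    refine (e.continuousAt_symm hex).preimage_mem_nhds ?_
    rwa [e.left_inv hxe]
  obtain ⟨a, ha, hball⟩ := Metric.mem_nhds_iff.1
    (inter_mem (inter_mem ht' (e.open_target.mem_nhds hex)) hpre)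
  have hK'pos : (0 : ℝ) < K' + 1 := by positivity
  set v : ℝ≥0∞ := volume (Metric.ball (0 : EuclideanSpace ℝ (Fin d)) 1) with hv
  have hvpos : 0 < v := Metric.measure_ball_pos _ _ one_pos
  have hvfin : v < ⊤ := measure_ball_lt_top
  have hvr : 0 < v.toReal := ENNReal.toReal_pos hvpos.ne' hvfin.ne
  -- Half of the radius a is kept for the center e y and half for the model ball about it. The added
  -- ones keep the constants positive when a Lipschitz constant is zero.
  refine ⟨e.source ∩ e ⁻¹' Metric.ball (e x) (a / 2), inter_mem (e.open_source.mem_nhds hxe)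
    ((e.continuousAt hxe).preimage_mem_nhds (Metric.ball_mem_nhds _ (by positivity))),
    v.toReal / ((K + 1) * (2 * (K' + 1))) ^ d, by positivity, (K' + 1) * (a / 2), by positivity, ?_⟩
  rintro y ⟨hye, hya⟩ hyΩ s hs hss
  set m : ℝ := s / (K' + 1) with hm
  have hmpos : 0 < m := by positivity
  have hma : m ≤ a / 2 := by rw [hm, div_le_iff₀ hK'pos]; linarith
  have hsub : Metric.ball (e y) m ⊆ Metric.ball (e x) a := by
    refine Metric.ball_subset_ball' ?_
    have : dist (e y) (e x) < a / 2 := hya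
    linarith
  have heyM : e y ∈ M := (him hye).2 hyΩ
  set B := M ∩ Metric.ball (e y) m with hB
  have hBa : B ⊆ Metric.ball (e x) a := inter_subset_right.trans hsub
  have hS : e.symm '' B ⊆ Ω ∩ Metric.ball y s := by
    rintro _ ⟨z, hz, rfl⟩
    have hz' := hball (hBa hz)
    refine ⟨(him.symm_apply_mem_iff hz'.1.2).2 hz.1, ?_⟩
    have h₁ := hK'.dist_le_mul z hz'.1.1 (e y) (hball (hsub (Metric.mem_ball_self hmpos))).1.1
    rw [e.left_inv hye] at h₁
    rw [Metric.mem_ball]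
    have h₂ : dist z (e y) < m := hz.2
    have h₃ : (K' + 1 : ℝ) * m = s := by rw [hm]; field_simp
    nlinarith [K'.2, dist_nonneg (x := z) (y := e y), show (0 : ℝ) ≤ K' from K'.2]
  have hBim : B = e '' (e.symm '' B) := by
    rw [image_image]
    refine Eq.symm ?_
    have : EqOn (fun z => e (e.symm z)) id B := fun z hz => e.right_inv (hball (hBa hz)).1.2
    rw [this.image_eq, image_id]
  have hLip : LipschitzOnWith K e (e.symm '' B) := by
    refine hK.mono ?_
    rintro _ ⟨z, hz, rfl⟩
    exact (hball (hBa hz)).2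
  have h₁ := le_euclideanHausdorffMeasure_model hd hdp hM' heyM hmpos
  rw [← hB, hBim] at h₁
  have h₂ := h₁.trans ((euclideanHausdorffMeasure_image_le d hLip).trans
    (mul_le_mul_right (measure_mono hS) _))
  have h₃ : (K : ℝ≥0∞) ^ d ≤ ENNReal.ofReal ((K + 1) ^ d) := by
    rw [ENNReal.ofReal_pow (by positivity)]
    gcongr
    rw [← ENNReal.ofReal_coe_nnreal]
    exact ENNReal.ofReal_le_ofReal (by linarith)
  have h₄ := h₂.trans (mul_le_mul_left h₃ _)
  rw [← hv, ← ENNReal.ofReal_toReal hvfin.ne, ← ENNReal.ofReal_mul (by positivity), mul_comm,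
    mul_comm (ENNReal.ofReal ((_ : ℝ) ^ d)), ← ENNReal.div_le_iff (by simp; positivity) (by simp),
    ← ENNReal.ofReal_div_of_pos (by positivity)] at h₄
  refine le_trans (ENNReal.ofReal_le_ofReal (le_of_eq ?_)) h₄
  rw [hm]
  simp only [mul_pow, div_pow]
  field_simp

theorem exists_le_surf_ball {p d : ℕ} (hd : 1 ≤ d) (hdp : d ≤ p)
    {Ω : Set (EuclideanSpace ℝ (Fin p))} (hΩc : IsCompact Ω) (hΩ : IsSmoothSubmanifold d Ω) :
    ∃ c : ℝ, 0 < c ∧ ∃ s₀ : ℝ, 0 < s₀ ∧ ∀ y ∈ Ω, ∀ s, 0 < s → s ≤ s₀ →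
      ENNReal.ofReal (c * s ^ d) ≤ surf d Ω (Metric.ball y s) := by
  -- The doubled membership separates the set that varies in the compactness induction from Ω
  -- itself; unions are handled by taking minima of the constants.
  suffices h : ∃ c : ℝ, 0 < c ∧ ∃ s₀ : ℝ, 0 < s₀ ∧ ∀ y ∈ Ω, y ∈ Ω → ∀ s, 0 < s → s ≤ s₀ →
      ENNReal.ofReal (c * s ^ d) ≤
        (Measure.euclideanHausdorffMeasure d) (Ω ∩ Metric.ball y s) by
    obtain ⟨c, hc, s₀, hs₀, h⟩ := h
    refine ⟨c, hc, s₀, hs₀, fun y hy s hs hss => (h y hy hy s hs hss).trans_eq ?_⟩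
    rw [surf, Measure.restrict_apply Metric.isOpen_ball.measurableSet, inter_comm]
  refine hΩc.induction_on (p := fun S => ∃ c : ℝ, 0 < c ∧ ∃ s₀ : ℝ, 0 < s₀ ∧ ∀ y ∈ S, y ∈ Ω →
    ∀ s, 0 < s → s ≤ s₀ → ENNReal.ofReal (c * s ^ d) ≤
        (Measure.euclideanHausdorffMeasure d) (Ω ∩ Metric.ball y s)) ?_ ?_ ?_ ?_
  · exact ⟨1, one_pos, 1, one_pos, by simp⟩
  · rintro S T hST ⟨c, hc, s₀, hs₀, h⟩
    exact ⟨c, hc, s₀, hs₀, fun y hy => h y (hST hy)⟩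
  · rintro S T ⟨c, hc, s₀, hs₀, h⟩ ⟨c', hc', s₀', hs₀', h'⟩
    refine ⟨min c c', lt_min hc hc', min s₀ s₀', lt_min hs₀ hs₀', ?_⟩
    rintro y (hy | hy) hyΩ s hs hss
    · refine le_trans (ENNReal.ofReal_le_ofReal ?_)
        (h y hy hyΩ s hs (hss.trans (min_le_left _ _)))
      gcongr
      exact min_le_left _ _
    · refine le_trans (ENNReal.ofReal_le_ofReal ?_)
        (h' y hy hyΩ s hs (hss.trans (min_le_right _ _)))
      gcongr
      exact min_le_right _ _
  · intro x hx
    obtain ⟨t, ht, h⟩ := exists_nhds_le_measure_ball hd hdp hΩ hx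
    exact ⟨t, mem_nhdsWithin_of_mem_nhds ht, h⟩

/-! ### Empirical measures -/

theorem empirical_apply {p n : ℕ} (X : Fin n → EuclideanSpace ℝ (Fin p))
    {S : Set (EuclideanSpace ℝ (Fin p))} (hS : MeasurableSet S)
    [DecidablePred fun i => X i ∈ S] :
    (empirical n X : Measure (EuclideanSpace ℝ (Fin p))) S =
      (n : ℝ≥0∞)⁻¹ * ((Finset.univ.filter fun i => X i ∈ S).card : ℝ≥0∞) := by
  change ((n : ℝ≥0∞)⁻¹ • ∑ j, Measure.dirac (X j)) S = _
  simp only [Measure.smul_apply, Measure.finsetSum_apply, smul_eq_mul,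
    Measure.dirac_apply' _ hS, Finset.card_filter, Nat.cast_sum]
  congr 1
  refine Finset.sum_congr rfl fun i _ => ?_
  by_cases h : X i ∈ S <;> simp [h]

theorem isProbabilityMeasure_empirical {p n : ℕ} (hn : 1 ≤ n)
    (X : Fin n → EuclideanSpace ℝ (Fin p)) :
    IsProbabilityMeasure (empirical n X : Measure (EuclideanSpace ℝ (Fin p))) := by
  classical
  refine ⟨?_⟩
  rw [empirical_apply X MeasurableSet.univ]
  simp only [mem_univ, Finset.filter_true, Finset.card_univ, Fintype.card_fin]
  exact ENNReal.inv_mul_cancel (by simp; omega) (by simp)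

/-- Total mass is weakly continuous, so the limit is again a probability measure. Passing to
`ProbabilityMeasure` gives access to the open-set portmanteau inequality and to continuity of
products. -/
theorem exists_tendsto_probabilityMeasure {α : Type*} [MeasurableSpace α] [TopologicalSpace α]
    [OpensMeasurableSpace α] {μs : ℕ → FiniteMeasure α}
    (hμs : ∀ m, IsProbabilityMeasure (μs m : Measure α)) {μ : FiniteMeasure α}
    (h : Tendsto μs atTop (𝓝 μ)) :
    ∃ (P : ℕ → ProbabilityMeasure α) (Q : ProbabilityMeasure α),
      (∀ m, (P m : Measure α) = μs m) ∧ (Q : Measure α) = μ ∧ Tendsto P atTop (𝓝 Q) := by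
  have hμ : IsProbabilityMeasure (μ : Measure α) := by
    have h₁ : Tendsto (fun m => (μs m).mass) atTop (𝓝 μ.mass) :=
      (FiniteMeasure.continuous_mass.tendsto μ).comp h
    have h₂ : ∀ m, (μs m).mass = 1 := fun m => by
      have := (hμs m).measure_univ
      simp [FiniteMeasure.mass, this, FiniteMeasure.coeFn_def]
    simp only [h₂] at h₁
    have h₃ : μ.mass = 1 := (tendsto_nhds_unique h₁ tendsto_const_nhds)
    refine ⟨?_⟩
    rw [← FiniteMeasure.ennreal_mass, h₃]; rfl
  refine ⟨fun m => ⟨μs m, hμs m⟩, ⟨μ, hμ⟩, fun _ => rfl, rfl, ?_⟩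
  exact (ProbabilityMeasure.tendsto_nhds_iff_toFiniteMeasure_tendsto_nhds atTop).2 h

theorem le_liminf_measure_open_of_tendsto {α : Type*} [MeasurableSpace α] [TopologicalSpace α]
    [OpensMeasurableSpace α] [HasOuterApproxClosed α] {μs : ℕ → FiniteMeasure α}
    (hμs : ∀ m, IsProbabilityMeasure (μs m : Measure α)) {μ : FiniteMeasure α}
    (h : Tendsto μs atTop (𝓝 μ)) {G : Set α} (hG : IsOpen G) :
    (μ : Measure α) G ≤ liminf (fun m => (μs m : Measure α) G) atTop := by
  obtain ⟨P, Q, hP, hQ, hPQ⟩ := exists_tendsto_probabilityMeasure hμs h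
  have := ProbabilityMeasure.le_liminf_measure_open_of_tendsto hPQ hG
  simpa only [hP, hQ] using this

/-! ### Packing and covering functionals -/

theorem ballVol_pos (d : ℕ) : 0 < ballVol d := by
  unfold ballVol
  have : 0 < Real.Gamma ((d : ℝ) / 2 + 1) := Real.Gamma_pos_of_pos (by positivity)
  positivity

theorem le_packAt {p : ℕ} (d : ℕ) {ι : Type*} (T : Finset ι) (c : ι → EuclideanSpace ℝ (Fin p))
    {X : Set (EuclideanSpace ℝ (Fin p))} {δ : ℝ} (hc : ∀ i ∈ T, c i ∈ X)
    (hT : ∀ i ∈ T, ∀ j ∈ T, i ≠ j →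
      Disjoint (Metric.closedBall (c i) δ) (Metric.closedBall (c j) δ)) :
    ENNReal.ofReal (T.card * ballVol d * δ ^ d) ≤ packAt d X δ := by
  refine le_sSup ⟨T.card, fun i => c (T.equivFin.symm i), fun i => hc _ (T.equivFin.symm i).2,
    fun i j hij => hT _ (T.equivFin.symm i).2 _ (T.equivFin.symm j).2 fun h => hij ?_, rfl⟩
  exact T.equivFin.symm.injective (Subtype.ext h)

theorem coverAt_le {p : ℕ} (d : ℕ) (T : Finset (EuclideanSpace ℝ (Fin p)))
    {X : Set (EuclideanSpace ℝ (Fin p))} {δ : ℝ} (hT : ∀ t ∈ T, t ∈ X)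
    (hX : ∀ x ∈ X, ∃ t ∈ T, dist x t ≤ δ) :
    coverAt d X δ ≤ ENNReal.ofReal (T.card * ballVol d * δ ^ d) := by
  refine sInf_le ⟨T.card, fun i => T.equivFin.symm i, fun i => hT _ (T.equivFin.symm i).2,
    fun x hx => ?_, rfl⟩
  obtain ⟨t, ht, hxt⟩ := hX x hx
  exact mem_iUnion.2 ⟨T.equivFin ⟨t, ht⟩, by simpa using hxt⟩

/-- A maximal separated set is automatically a net; total boundedness makes it finite, since a
packing at scale h is no larger than a covering at scale h/2. -/
theorem exists_finset_separated_net {α : Type*} [PseudoMetricSpace α] {B : Set α}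
    (hB : TotallyBounded B) {h : ℝ} (hh : 0 < h) :
    ∃ T : Finset α, (∀ t ∈ T, t ∈ B) ∧ (∀ s ∈ T, ∀ t ∈ T, s ≠ t → h < dist s t) ∧
      ∀ x ∈ B, ∃ t ∈ T, dist x t ≤ h := by
  set ε : NNReal := ⟨h / 2, by positivity⟩ with hε
  have hε0 : ε ≠ 0 := by
    intro h0
    have : h / 2 = 0 := congrArg NNReal.toReal h0
    linarith
  have h2ε : ((2 * ε : NNReal) : ℝ) = h := by
    rw [NNReal.coe_mul]; change 2 * (h / 2) = h; ring
  have hfin : Metric.packingNumber (2 * ε) B ≠ ⊤ := by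
    obtain ⟨N, -, hN, hcov⟩ := Metric.exists_finite_isCover_of_totallyBounded hε0 hB
    refine ne_top_of_le_ne_top ?_ ((Metric.packingNumber_two_mul_le_externalCoveringNumber ε B).trans
      hcov.externalCoveringNumber_le_encard)
    exact hN.encard_lt_top.ne
  have hTf : (Metric.maximalSeparatedSet (2 * ε) B).Finite := by
    rw [← encard_ne_top_iff, Metric.encard_maximalSeparatedSet hfin]
    exact hfin
  have hed : ∀ x y : α, edist x y = ENNReal.ofReal (dist x y) := fun x y => edist_dist x y
  have hcoe : ((2 * ε : NNReal) : ℝ≥0∞) = ENNReal.ofReal h := by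
    rw [← h2ε, ENNReal.ofReal_coe_nnreal]
  refine ⟨hTf.toFinset, fun t ht => ?_, fun s hs t ht hst => ?_, fun x hx => ?_⟩
  · exact Metric.maximalSeparatedSet_subset (hTf.mem_toFinset.1 ht)
  · have := Metric.isSeparated_maximalSeparatedSet (hTf.mem_toFinset.1 hs)
      (hTf.mem_toFinset.1 ht) hst
    rw [hcoe, hed] at this
    exact (ENNReal.ofReal_lt_ofReal_iff_of_nonneg hh.le).1 this
  · obtain ⟨t, ht, hxt⟩ := Metric.isCover_maximalSeparatedSet hfin hx
    refine ⟨t, hTf.mem_toFinset.2 ht, ?_⟩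
    simp only [mem_ofPred_eq] at hxt
    rw [hcoe, hed] at hxt
    exact (ENNReal.ofReal_le_ofReal_iff hh.le).1 hxt

/-! ### Open sets with null frontier -/

theorem surf_apply_eq_image {p d : ℕ} {Ω : Set (EuclideanSpace ℝ (Fin p))} (hΩ : IsCompact Ω)
    (V : Set (EuclideanSpace ℝ (Fin p))) :
    surf d Ω ((↑) '' ((↑) ⁻¹' V : Set Ω)) = surf d Ω V := by
  rw [Subtype.image_preimage_coe, surf, Measure.restrict_apply' hΩ.measurableSet,
    Measure.restrict_apply' hΩ.measurableSet]
  congr 1; ext x; simp; tauto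

/-- This is the condition under which the Euclidean-type hypothesis applies to the trace of V on Ω:
the relative closure adds only points of the ambient frontier. -/
theorem surf_image_closure_eq {p d : ℕ} {Ω : Set (EuclideanSpace ℝ (Fin p))} (hΩ : IsCompact Ω)
    {V : Set (EuclideanSpace ℝ (Fin p))} (hV : surf d Ω (frontier V) = 0) :
    surf d Ω ((↑) '' ((↑) ⁻¹' V : Set Ω)) = surf d Ω ((↑) '' closure ((↑) ⁻¹' V : Set Ω)) := by
  refine le_antisymm (measure_mono (image_mono subset_closure)) ?_
  have h : ((↑) '' closure ((↑) ⁻¹' V : Set Ω) : Set (EuclideanSpace ℝ (Fin p))) ⊆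
      V ∪ frontier V := by
    rintro _ ⟨x, hx, rfl⟩
    rw [← closure_eq_self_union_frontier]
    exact continuous_subtype_val.closure_preimage_subset V hx
  calc _ ≤ surf d Ω (V ∪ frontier V) := measure_mono h
    _ ≤ surf d Ω V + surf d Ω (frontier V) := measure_union_le _ _
    _ = _ := by rw [hV, add_zero, surf_apply_eq_image hΩ]

theorem tendsto_scale_nhds_zero {d : ℕ} (hd : 1 ≤ d) {ψ : ℕ → ℕ} (hψ : Tendsto ψ atTop atTop) {a : ℝ} :
    Tendsto (fun m => a * (ψ m : ℝ) ^ (-(1 : ℝ) / d)) atTop (𝓝 0) := by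
  have h : Tendsto (fun x : ℝ => x ^ (-(1 / (d : ℝ)))) atTop (𝓝 0) :=
    tendsto_rpow_neg_atTop (by positivity)
  have h₂ := (h.comp (tendsto_natCast_atTop_atTop.comp hψ)).const_mul a
  simpa [Function.comp_def, neg_div] using h₂

theorem scale_pos {n d : ℕ} (hn : 1 ≤ n) {a : ℝ} (ha : 0 < a) :
    0 < a * (n : ℝ) ^ (-(1 : ℝ) / d) := by
  have : (0 : ℝ) < n := by exact_mod_cast hn
  positivity

theorem scale_pow {n d : ℕ} (hd : 1 ≤ d) (a : ℝ) :
    (a * (n : ℝ) ^ (-(1 : ℝ) / d)) ^ d = a ^ d / n := by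
  have hd' : (d : ℝ) ≠ 0 := by positivity
  rw [mul_pow, ← Real.rpow_natCast ((n : ℝ) ^ (-(1 : ℝ) / d)), ← Real.rpow_mul (by positivity),
    div_mul_cancel₀ _ hd', Real.rpow_neg_one, div_eq_mul_inv]

theorem tendsto_scale_nhdsGT {d : ℕ} (hd : 1 ≤ d) {ψ : ℕ → ℕ} (hψ : Tendsto ψ atTop atTop)
    (hψ1 : ∀ m, 1 ≤ ψ m) {a : ℝ} (ha : 0 < a) :
    Tendsto (fun m => a * (ψ m : ℝ) ^ (-(1 : ℝ) / d)) atTop (𝓝[>] 0) :=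
  tendsto_nhdsWithin_iff.2 ⟨tendsto_scale_nhds_zero hd hψ,
    Eventually.of_forall fun m => scale_pos (hψ1 m) ha⟩

/-! ### Density bounds in the limit -/

/-- The points lying in V are themselves a packing of `V ∩ Ω`, and their number is n times the
empirical mass of V. The factor η < 1 is needed because the separation inequality is not strict and
closed balls of radius exactly r n^(-1/d)/2 could touch. -/
theorem limit_mul_le_packLim {p d : ℕ} (hd : 1 ≤ d)
    {Ω : Set (EuclideanSpace ℝ (Fin p))} {r R : ℝ} (hr : 0 < r)
    {ψ : ℕ → ℕ} (hψ : Tendsto ψ atTop atTop) (hψ1 : ∀ m, 1 ≤ ψ m)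
    {Y : (n : ℕ) → Fin n → EuclideanSpace ℝ (Fin p)}
    (hY : ∀ m, IsAdmissible d Ω r R (ψ m) (Y (ψ m)))
    {ν : FiniteMeasure (EuclideanSpace ℝ (Fin p))}
    (hν : Tendsto (fun m => empirical (ψ m) (Y (ψ m))) atTop (𝓝 ν))
    {V : Set (EuclideanSpace ℝ (Fin p))} (hV : IsOpen V) {η : ℝ} (hη : 0 < η) (hη1 : η < 1) :
    ENNReal.ofReal (ballVol d * (η * (r / 2)) ^ d) * (ν : Measure _) V ≤
      packLim d ((↑) '' ((↑) ⁻¹' V : Set Ω) : Set (EuclideanSpace ℝ (Fin p))) := by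
  classical
  set U : Set (EuclideanSpace ℝ (Fin p)) := (↑) '' ((↑) ⁻¹' V : Set Ω) with hU
  set a : ℝ := η * (r / 2) with ha
  have hapos : 0 < a := by positivity
  have hstep : ∀ m, ENNReal.ofReal (ballVol d * a ^ d) *
      (empirical (ψ m) (Y (ψ m)) : Measure (EuclideanSpace ℝ (Fin p))) V ≤
      packAt d U (a * (ψ m : ℝ) ^ (-(1 : ℝ) / d)) := by
    intro m
    set n := ψ m with hn
    have hn1 : 1 ≤ n := hψ1 m
    have hnpos : (0 : ℝ) < n := by exact_mod_cast hn1
    obtain ⟨h₁, h₂, -⟩ := hY m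
    refine le_trans (le_of_eq ?_) (le_packAt d (Finset.univ.filter fun i => Y n i ∈ V) (Y n)
      (fun i hi => ?_) fun i _ j _ hij => ?_)
    · rw [empirical_apply _ hV.measurableSet, scale_pow hd, ← ENNReal.ofReal_natCast n,
        ← ENNReal.ofReal_inv_of_pos hnpos, ← ENNReal.ofReal_natCast (Finset.card _),
        ← ENNReal.ofReal_mul (by positivity), ← ENNReal.ofReal_mul
          (by have := ballVol_pos d; positivity)]
      congr 1
      field_simp
    · exact ⟨⟨Y n i, h₁ i⟩, (Finset.mem_filter.1 hi).2, rfl⟩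
    · refine Metric.closedBall_disjoint_closedBall (lt_of_lt_of_le ?_ (h₂ i j hij))
      have : (0 : ℝ) < (n : ℝ) ^ (-(1 : ℝ) / d) := by positivity
      rw [← add_mul]
      refine mul_lt_mul_of_pos_right ?_ this
      rw [ha]; nlinarith
  have hlim := le_liminf_measure_open_of_tendsto
    (fun m => isProbabilityMeasure_empirical (hψ1 m) (Y (ψ m))) hν hV
  calc _ ≤ ENNReal.ofReal (ballVol d * a ^ d) * liminf (fun m =>
        (empirical (ψ m) (Y (ψ m)) : Measure (EuclideanSpace ℝ (Fin p))) V) atTop := by gcongr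
    _ ≤ liminf (fun m => ENNReal.ofReal (ballVol d * a ^ d) *
        (empirical (ψ m) (Y (ψ m)) : Measure (EuclideanSpace ℝ (Fin p))) V) atTop := by
      rw [ENNReal.liminf_const_mul_of_ne_top ENNReal.ofReal_ne_top]
    _ ≤ liminf (fun m => packAt d U (a * (ψ m : ℝ) ^ (-(1 : ℝ) / d))) atTop :=
      liminf_le_liminf (Eventually.of_forall hstep)
    _ ≤ limsup (fun m => packAt d U (a * (ψ m : ℝ) ^ (-(1 : ℝ) / d))) atTop := liminf_le_limsup
    _ = limsup (packAt d U) (map (fun m => a * (ψ m : ℝ) ^ (-(1 : ℝ) / d)) atTop) := rfl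
    -- The radii form one particular sequence tending to 0 from the right, so its limsup is at most
    -- the limsup over all δ.
    _ ≤ packLim d U := limsup_le_limsup_of_le (tendsto_scale_nhdsGT hd hψ hψ1 hapos)

theorem limit_open_le {p d : ℕ} (hd : 1 ≤ d)
    {Ω : Set (EuclideanSpace ℝ (Fin p))} (hΩ : IsCompact Ω) (hE : IsEuclideanType d Ω)
    {r R ρplus : ℝ} (hr : 0 < r) (hρ : 0 < ρplus)
    (hpack : 2 ^ d * packingDensity d ≤ ENNReal.ofReal (ρplus * r ^ d * ballVol d))
    {ψ : ℕ → ℕ} (hψ : Tendsto ψ atTop atTop) (hψ1 : ∀ m, 1 ≤ ψ m)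
    {Y : (n : ℕ) → Fin n → EuclideanSpace ℝ (Fin p)}
    (hY : ∀ m, IsAdmissible d Ω r R (ψ m) (Y (ψ m)))
    {ν : FiniteMeasure (EuclideanSpace ℝ (Fin p))}
    (hν : Tendsto (fun m => empirical (ψ m) (Y (ψ m))) atTop (𝓝 ν))
    {V : Set (EuclideanSpace ℝ (Fin p))} (hV : IsOpen V) (hVf : surf d Ω (frontier V) = 0) :
    (ν : Measure _) V ≤ ENNReal.ofReal ρplus * surf d Ω V := by
  have hb := ballVol_pos d
  have hlim : (packLim d ((↑) '' ((↑) ⁻¹' V : Set Ω) : Set (EuclideanSpace ℝ (Fin p)))) =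
      surf d Ω V * packingDensity d := by
    rw [(hE _ (hV.preimage continuous_subtype_val) (surf_image_closure_eq hΩ hVf)).1,
      surf_apply_eq_image hΩ]
  have key : ∀ η : ℝ, 0 < η → η < 1 →
      ENNReal.ofReal (η ^ d) * (ν : Measure _) V ≤ ENNReal.ofReal ρplus * surf d Ω V := by
    intro η hη hη1
    have h := limit_mul_le_packLim hd hr hψ hψ1 hY hν hV hη hη1
    rw [hlim] at h
    -- The 2^d in the packing hypothesis compensates for balls of radius r/2 rather than r. The
    -- common factor is then cancelled, and η is sent to 1 below.
    have h₂ : ENNReal.ofReal (r ^ d * ballVol d) * (ENNReal.ofReal (η ^ d) * (ν : Measure _) V) ≤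
        ENNReal.ofReal (r ^ d * ballVol d) * (ENNReal.ofReal ρplus * surf d Ω V) := by
      calc _ = 2 ^ d * (ENNReal.ofReal (ballVol d * (η * (r / 2)) ^ d) * (ν : Measure _) V) := by
            have : (2 : ℝ≥0∞) ^ d = ENNReal.ofReal (2 ^ d) := by
              rw [ENNReal.ofReal_pow (by norm_num)]; norm_num
            rw [this, ← mul_assoc, ← mul_assoc, ← ENNReal.ofReal_mul (by positivity),
              ← ENNReal.ofReal_mul (by positivity)]
            congr 2
            rw [mul_pow, div_pow]; field_simp
        _ ≤ 2 ^ d * (surf d Ω V * packingDensity d) := by gcongr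
        _ = surf d Ω V * (2 ^ d * packingDensity d) := by ring
        _ ≤ surf d Ω V * ENNReal.ofReal (ρplus * r ^ d * ballVol d) := by gcongr
        _ = _ := by
            rw [mul_assoc ρplus, ENNReal.ofReal_mul hρ.le]; ring
    exact (ENNReal.mul_le_mul_iff_right (by simp; positivity) ENNReal.ofReal_ne_top).1 h₂
  have hcont : Tendsto (fun η : ℝ => ENNReal.ofReal (η ^ d) * (ν : Measure _) V) (𝓝[<] 1)
      (𝓝 (ENNReal.ofReal (1 ^ d) * (ν : Measure _) V)) := by
    refine ENNReal.Tendsto.mul_const ?_ (Or.inl (by simp))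
    refine (ENNReal.continuous_ofReal.tendsto _).comp ?_
    exact ((continuous_pow d).tendsto 1).mono_left nhdsWithin_le_nhds
  rw [one_pow, ENNReal.ofReal_one, one_mul] at hcont
  refine le_of_tendsto hcont ?_
  filter_upwards [Ioo_mem_nhdsLT (show (0 : ℝ) < 1 by norm_num)] with η hη
  exact key η hη.1 hη.2

/-! ### The covering constraint and the lower density bound -/

/-- The collars decrease to `closure V ∩ closure Vᶜ`, the frontier, so continuity from above
applies. -/
theorem tendsto_measure_collar {α : Type*} [PseudoMetricSpace α] [MeasurableSpace α]
    [OpensMeasurableSpace α] (μ : Measure α) [IsFiniteMeasure μ] {V : Set α}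
    (hV : μ (frontier V) = 0) :
    Tendsto (fun ε : ℝ => μ (Metric.cthickening ε V ∩ Metric.cthickening ε Vᶜ)) (𝓝[>] 0)
      (𝓝 0) := by
  have h := tendsto_measure_biInter_gt (μ := μ) (a := (0 : ℝ))
    (s := fun ε : ℝ => Metric.cthickening ε V ∩ Metric.cthickening ε Vᶜ)
    (fun ε _ => (Metric.isClosed_cthickening.inter
      Metric.isClosed_cthickening).measurableSet.nullMeasurableSet)
    (fun i j _ hij => inter_subset_inter (Metric.cthickening_mono hij _)
      (Metric.cthickening_mono hij _)) ⟨1, one_pos, measure_ne_top _ _⟩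
  have heq : (⋂ ε : ℝ, ⋂ (_ : ε > 0), (Metric.cthickening ε V ∩ Metric.cthickening ε Vᶜ)) =
      frontier V := by
    rw [frontier_eq_closure_inter_closure, Metric.closure_eq_iInter_cthickening V,
      Metric.closure_eq_iInter_cthickening Vᶜ]
    simp only [iInter_inter_distrib]
  rw [heq, hV] at h
  exact h

theorem card_mul_le_surf {p d : ℕ} {Ω : Set (EuclideanSpace ℝ (Fin p))} {c s₀ : ℝ}
    (hA : ∀ y ∈ Ω, ∀ s, 0 < s → s ≤ s₀ →
      ENNReal.ofReal (c * s ^ d) ≤ surf d Ω (Metric.ball y s))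
    {T : Finset (EuclideanSpace ℝ (Fin p))} (hTΩ : ∀ t ∈ T, t ∈ Ω) {s : ℝ} (hs : 0 < s)
    (hss : s ≤ s₀) (hT : ∀ x ∈ T, ∀ y ∈ T, x ≠ y → 2 * s < dist x y)
    {A : Set (EuclideanSpace ℝ (Fin p))} (hTA : ∀ t ∈ T, Metric.ball t s ⊆ A) :
    ENNReal.ofReal (T.card * (c * s ^ d)) ≤ surf d Ω A := by
  calc ENNReal.ofReal (T.card * (c * s ^ d)) = ∑ _t ∈ T, ENNReal.ofReal (c * s ^ d) := by
        rw [Finset.sum_const, nsmul_eq_mul, ENNReal.ofReal_mul (by positivity),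
          ENNReal.ofReal_natCast]
    _ ≤ ∑ t ∈ T, surf d Ω (Metric.ball t s) :=
        Finset.sum_le_sum fun t ht => hA t (hTΩ t ht) s hs hss
    _ = surf d Ω (⋃ t ∈ T, Metric.ball t s) :=
        (measure_biUnion_finset (fun x hx y hy hxy => Metric.ball_disjoint_ball
          (by linarith [hT x hx y hy hxy])) fun t _ => Metric.isOpen_ball.measurableSet).symm
    _ ≤ surf d Ω A := measure_mono (iUnion₂_subset hTA)

/-- The points of the configuration in V may fail to cover `V ∩ Ω`, since a point near the frontier
may be covered only from outside V. The exceptional set lies within h of the complement and is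
covered by an h-separated net. The balls of radius h/2 about the net are disjoint and stay in the
collar, so Ahlfors regularity bounds their number by its measure. -/
theorem coverAt_le_of_admissible {p d : ℕ} (hd : 1 ≤ d)
    {Ω : Set (EuclideanSpace ℝ (Fin p))} (hΩ : IsCompact Ω) {c s₀ : ℝ} (hc : 0 < c)
    (hA : ∀ y ∈ Ω, ∀ s, 0 < s → s ≤ s₀ →
      ENNReal.ofReal (c * s ^ d) ≤ surf d Ω (Metric.ball y s))
    {r R : ℝ} (hR : 0 < R) {n : ℕ} (hn : 1 ≤ n) {X : Fin n → EuclideanSpace ℝ (Fin p)}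
    (hX : IsAdmissible d Ω r R n X) {V : Set (EuclideanSpace ℝ (Fin p))} (hV : IsOpen V) {h : ℝ}
    (hh : h = R * (n : ℝ) ^ (-(1 : ℝ) / d)) (hs₀ : h / 2 ≤ s₀) :
    coverAt d ((↑) '' ((↑) ⁻¹' V : Set Ω) : Set (EuclideanSpace ℝ (Fin p))) h ≤
      ENNReal.ofReal (ballVol d * R ^ d) *
        (empirical n X : Measure (EuclideanSpace ℝ (Fin p))) V +
      ENNReal.ofReal (ballVol d * 2 ^ d / c) *
        surf d Ω (Metric.cthickening (2 * h) V ∩ Metric.cthickening (2 * h) Vᶜ) := by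
  classical
  have hb := ballVol_pos d
  have hhpos : 0 < h := hh ▸ scale_pos hn hR
  have hnpos : (0 : ℝ) < n := by exact_mod_cast hn
  obtain ⟨hXΩ, -, hXR⟩ := hX
  set B : Set (EuclideanSpace ℝ (Fin p)) := {y | y ∈ Ω ∧ y ∈ V ∧ ∃ z ∈ Vᶜ, dist y z ≤ h} with hB
  obtain ⟨T, hTB, hTsep, hTcov⟩ := exists_finset_separated_net
    (hΩ.totallyBounded.subset (fun y hy => hy.1 : B ⊆ Ω)) hhpos
  set N := Finset.univ.filter fun i => X i ∈ V with hN
  have hcover : coverAt d ((↑) '' ((↑) ⁻¹' V : Set Ω) : Set (EuclideanSpace ℝ (Fin p))) h ≤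
      ENNReal.ofReal ((N.image X ∪ T).card * ballVol d * h ^ d) := by
    refine coverAt_le d _ (fun t ht => ?_) fun x hx => ?_
    · rcases Finset.mem_union.1 ht with ht | ht
      · obtain ⟨i, hi, rfl⟩ := Finset.mem_image.1 ht
        exact ⟨⟨X i, hXΩ i⟩, (Finset.mem_filter.1 hi).2, rfl⟩
      · exact ⟨⟨t, (hTB t ht).1⟩, (hTB t ht).2.1, rfl⟩
    · obtain ⟨⟨y, hyΩ⟩, hyV, rfl⟩ := hx
      obtain ⟨i, hi⟩ := hXR y hyΩ
      rw [← hh, dist_comm] at hi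
      by_cases hiV : X i ∈ V
      · exact ⟨X i, Finset.mem_union_left _ (Finset.mem_image_of_mem _
          (Finset.mem_filter.2 ⟨Finset.mem_univ _, hiV⟩)), hi⟩
      · obtain ⟨t, ht, hyt⟩ := hTcov y ⟨hyΩ, hyV, X i, hiV, hi⟩
        exact ⟨t, Finset.mem_union_right _ ht, hyt⟩
  have hTcard := card_mul_le_surf hA (T := T) (fun t ht => (hTB t ht).1) (half_pos hhpos) hs₀
    (fun x hx y hy hxy => by linarith [hTsep x hx y hy hxy])
    (A := Metric.cthickening (2 * h) V ∩ Metric.cthickening (2 * h) Vᶜ) (by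
      intro t ht x hx
      obtain ⟨-, htV, z, hz, htz⟩ := hTB t ht
      rw [Metric.mem_ball] at hx
      exact ⟨Metric.mem_cthickening_of_dist_le x t _ _ htV (by linarith),
        Metric.mem_cthickening_of_dist_le x z _ _ hz
          (by linarith [dist_triangle x t z])⟩)
  have hcard : ((N.image X ∪ T).card : ℝ) ≤ N.card + T.card := by
    exact_mod_cast (Finset.card_union_le _ _).trans (Nat.add_le_add_right Finset.card_image_le _)
  refine hcover.trans ?_
  calc _ ≤ ENNReal.ofReal (N.card * ballVol d * h ^ d + T.card * ballVol d * h ^ d) := by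
        refine ENNReal.ofReal_le_ofReal ?_
        rw [← add_mul, ← add_mul]
        gcongr
    _ = ENNReal.ofReal (N.card * ballVol d * h ^ d) +
        ENNReal.ofReal (T.card * ballVol d * h ^ d) :=
        ENNReal.ofReal_add (by positivity) (by positivity)
    _ ≤ _ := by
        refine add_le_add (le_of_eq ?_) ?_
        · rw [empirical_apply _ hV.measurableSet, hh, scale_pow hd, ← ENNReal.ofReal_natCast n,
            ← ENNReal.ofReal_inv_of_pos hnpos, ← ENNReal.ofReal_natCast (Finset.card _),
            ← ENNReal.ofReal_mul (by positivity), ← ENNReal.ofReal_mul (by positivity)]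
          congr 1
          field_simp
          rfl
        · refine le_trans (le_of_eq ?_) (mul_le_mul_right hTcard _)
          rw [← ENNReal.ofReal_mul (by positivity), div_pow]
          congr 1
          field_simp

theorem coverLim_le_limit {p d : ℕ} (hd : 1 ≤ d) {Ω : Set (EuclideanSpace ℝ (Fin p))}
    (hΩ : IsCompact Ω) [IsFiniteMeasure (surf d Ω)] {c s₀ : ℝ} (hc : 0 < c) (hs₀ : 0 < s₀)
    (hA : ∀ y ∈ Ω, ∀ s, 0 < s → s ≤ s₀ →
      ENNReal.ofReal (c * s ^ d) ≤ surf d Ω (Metric.ball y s))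
    {r R : ℝ} (hR : 0 < R)
    {ψ : ℕ → ℕ} (hψ : Tendsto ψ atTop atTop) (hψ1 : ∀ m, 1 ≤ ψ m)
    {Y : (n : ℕ) → Fin n → EuclideanSpace ℝ (Fin p)}
    (hY : ∀ m, IsAdmissible d Ω r R (ψ m) (Y (ψ m)))
    {ν : FiniteMeasure (EuclideanSpace ℝ (Fin p))}
    (hν : Tendsto (fun m => empirical (ψ m) (Y (ψ m))) atTop (𝓝 ν))
    {V : Set (EuclideanSpace ℝ (Fin p))} (hV : IsOpen V) (hVf : surf d Ω (frontier V) = 0) :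
    coverLim d ((↑) '' ((↑) ⁻¹' V : Set Ω) : Set (EuclideanSpace ℝ (Fin p))) ≤
      ENNReal.ofReal (ballVol d * R ^ d) * (ν : Measure _) (closure V) := by
  set U : Set (EuclideanSpace ℝ (Fin p)) := (↑) '' ((↑) ⁻¹' V : Set Ω) with hU
  set h : ℕ → ℝ := fun m => R * (ψ m : ℝ) ^ (-(1 : ℝ) / d) with hh
  have hh0 : Tendsto h atTop (𝓝[>] 0) := tendsto_scale_nhdsGT hd hψ hψ1 hR
  have h2h : Tendsto (fun m => 2 * h m) atTop (𝓝[>] 0) := by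
    have := tendsto_scale_nhdsGT (d := d) hd hψ hψ1 (show (0 : ℝ) < 2 * R by positivity)
    simpa only [hh, mul_assoc] using this
  set e : ℕ → ℝ≥0∞ := fun m => ENNReal.ofReal (ballVol d * 2 ^ d / c) *
    surf d Ω (Metric.cthickening (2 * h m) V ∩ Metric.cthickening (2 * h m) Vᶜ) with he
  have he0 : Tendsto e atTop (𝓝 0) := by
    have := ENNReal.Tendsto.const_mul (a := ENNReal.ofReal (ballVol d * 2 ^ d / c))
      ((tendsto_measure_collar (surf d Ω) hVf).comp h2h) (Or.inr ENNReal.ofReal_ne_top)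
    simpa using this
  set g : ℕ → ℝ≥0∞ := fun m => ENNReal.ofReal (ballVol d * R ^ d) *
    (empirical (ψ m) (Y (ψ m)) : Measure (EuclideanSpace ℝ (Fin p))) (closure V) with hg
  have hev : ∀ᶠ m in atTop, coverAt d U (h m) ≤ g m + e m := by
    filter_upwards [hh0.eventually (Ioo_mem_nhdsGT (show (0 : ℝ) < 2 * s₀ by positivity))] with m hm
    refine (coverAt_le_of_admissible hd hΩ hc hA hR (hψ1 m) (hY m) hV rfl
      (by linarith [hm.2])).trans ?_
    simp only [hg, he]
    gcongr
    exact subset_closure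
  calc coverLim d U ≤ liminf (coverAt d U) (map h atTop) := liminf_le_liminf_of_le hh0
    _ = liminf (fun m => coverAt d U (h m)) atTop := rfl
    -- Passing to the limsup matches the portmanteau inequality for closed sets, which is why the
    -- closure of V appears.
    _ ≤ limsup (fun m => coverAt d U (h m)) atTop := liminf_le_limsup
    _ ≤ limsup (fun m => g m + e m) atTop := limsup_le_limsup hev
    _ = limsup g atTop := ENNReal.limsup_add_of_right_tendsto_zero he0 g
    _ = ENNReal.ofReal (ballVol d * R ^ d) * limsup (fun m =>
        (empirical (ψ m) (Y (ψ m)) : Measure (EuclideanSpace ℝ (Fin p))) (closure V)) atTop :=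
      ENNReal.limsup_const_mul_of_ne_top ENNReal.ofReal_ne_top
    _ ≤ _ := by
      gcongr
      exact FiniteMeasure.limsup_measure_closed_le_of_tendsto hν isClosed_closure

theorem le_limit_closure {p d : ℕ} (hd : 1 ≤ d) {Ω : Set (EuclideanSpace ℝ (Fin p))}
    (hΩ : IsCompact Ω) (hE : IsEuclideanType d Ω) [IsFiniteMeasure (surf d Ω)]
    {c s₀ : ℝ} (hc : 0 < c) (hs₀ : 0 < s₀)
    (hA : ∀ y ∈ Ω, ∀ s, 0 < s → s ≤ s₀ →
      ENNReal.ofReal (c * s ^ d) ≤ surf d Ω (Metric.ball y s))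
    {r R ρminus : ℝ} (hR : 0 < R) (hρ : 0 < ρminus)
    (hcover : ENNReal.ofReal (ρminus * R ^ d * ballVol d) ≤ coveringDensity d)
    {ψ : ℕ → ℕ} (hψ : Tendsto ψ atTop atTop) (hψ1 : ∀ m, 1 ≤ ψ m)
    {Y : (n : ℕ) → Fin n → EuclideanSpace ℝ (Fin p)}
    (hY : ∀ m, IsAdmissible d Ω r R (ψ m) (Y (ψ m)))
    {ν : FiniteMeasure (EuclideanSpace ℝ (Fin p))}
    (hν : Tendsto (fun m => empirical (ψ m) (Y (ψ m))) atTop (𝓝 ν))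
    {V : Set (EuclideanSpace ℝ (Fin p))} (hV : IsOpen V) (hVf : surf d Ω (frontier V) = 0) :
    ENNReal.ofReal ρminus * surf d Ω V ≤ (ν : Measure _) (closure V) := by
  have hb := ballVol_pos d
  have h := coverLim_le_limit hd hΩ hc hs₀ hA hR hψ hψ1 hY hν hV hVf
  rw [(hE _ (hV.preimage continuous_subtype_val) (surf_image_closure_eq hΩ hVf)).2.2.1,
    surf_apply_eq_image hΩ] at h
  refine (ENNReal.mul_le_mul_iff_right (a := ENNReal.ofReal (ballVol d * R ^ d))
    (by simp; positivity) ENNReal.ofReal_ne_top).1 (le_trans ?_ h)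
  calc _ = surf d Ω V * ENNReal.ofReal (ρminus * R ^ d * ballVol d) := by
        rw [mul_assoc ρminus, ENNReal.ofReal_mul hρ.le, mul_comm (R ^ d)]; ring
    _ ≤ _ := by gcongr

/-! ### From bounds on open sets to a density -/

/-- A compact subset of an open set has an open neighbourhood with null frontier whose closure lies
in that open set. -/
theorem exists_isOpen_null_frontier {α : Type*} [PseudoMetricSpace α] [MeasurableSpace α]
    [OpensMeasurableSpace α] (μ : Measure α) [SFinite μ] {K O : Set α} (hK : IsCompact K)
    (hO : IsOpen O) (hKO : K ⊆ O) :
    ∃ V, IsOpen V ∧ K ⊆ V ∧ closure V ⊆ O ∧ μ (frontier V) = 0 := by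
  obtain ⟨δ, hδ, hδO⟩ := hK.exists_cthickening_subset_open hO hKO
  obtain ⟨ε, hε, hε0⟩ := exists_null_frontier_thickening μ K hδ
  exact ⟨Metric.thickening ε K, Metric.isOpen_thickening, Metric.self_subset_thickening hε.1 K,
    (Metric.closure_thickening_subset_cthickening ε K).trans
      ((Metric.cthickening_mono hε.2.le K).trans hδO), hε0⟩

/-- Inner regularity of μ and outer regularity of ν leave room to insert an open set with null
frontier between K and O, where the limit bounds are available. -/
theorem measure_le_of_isCompact_isOpen {α : Type*} [PseudoMetricSpace α] [MeasurableSpace α]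
    [BorelSpace α] {μ ν : Measure α} [μ.InnerRegular] [ν.OuterRegular]
    (h : ∀ K O, IsCompact K → IsOpen O → K ⊆ O → μ K ≤ ν O) : μ ≤ ν := by
  refine Measure.le_iff.2 fun s hs => ?_
  rw [hs.measure_eq_iSup_isCompact μ]
  refine iSup₂_le fun K hKs => iSup_le fun hK => ?_
  refine le_trans ?_ (measure_mono hKs)
  rw [K.measure_eq_iInf_isOpen ν]
  exact le_iInf₂ fun O hKO => le_iInf fun hO => h K O hK hO hKO

theorem exists_density_of_le_of_le {α : Type*} [MeasurableSpace α] {μ ν : Measure α}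
    [IsFiniteMeasure μ] [IsProbabilityMeasure ν] {a b : ℝ} (hb : 0 ≤ b)
    (h₁ : ENNReal.ofReal a • μ ≤ ν) (h₂ : ν ≤ ENNReal.ofReal b • μ) :
    ∃ ρ : α → ℝ, MemLp ρ ⊤ μ ∧ Measurable ρ ∧ (∫ x, ρ x ∂μ = 1) ∧
      (∀ᵐ x ∂μ, a ≤ ρ x ∧ ρ x ≤ b) ∧ ν = μ.withDensity fun x => ENNReal.ofReal (ρ x) := by
  have hac : ν ≪ μ := (Measure.absolutelyContinuous_of_le h₂).trans
    Measure.smul_absolutelyContinuous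
  have hmeas : Measurable (ν.rnDeriv μ) := Measure.measurable_rnDeriv ν μ
  have hset : ∀ s, MeasurableSet s → ∫⁻ x in s, ν.rnDeriv μ x ∂μ = ν s := fun s _ =>
    Measure.setLIntegral_rnDeriv hac s
  have hlow : (fun _ => ENNReal.ofReal a) ≤ᵐ[μ] ν.rnDeriv μ := by
    refine ae_le_of_forall_setLIntegral_le_of_sigmaFinite measurable_const fun s hs _ => ?_
    rw [hset s hs, setLIntegral_const]
    simpa using h₁ s
  have hup : ν.rnDeriv μ ≤ᵐ[μ] fun _ => ENNReal.ofReal b := by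
    refine ae_le_of_forall_setLIntegral_le_of_sigmaFinite hmeas fun s hs _ => ?_
    rw [hset s hs, setLIntegral_const]
    simpa using h₂ s
  have hbd : ∀ᵐ x ∂μ, a ≤ (ν.rnDeriv μ x).toReal ∧ (ν.rnDeriv μ x).toReal ≤ b := by
    filter_upwards [hlow, hup] with x hx₁ hx₂
    have hfin : ν.rnDeriv μ x ≠ ⊤ := ne_top_of_le_ne_top ENNReal.ofReal_ne_top hx₂
    exact ⟨(ENNReal.ofReal_le_iff_le_toReal hfin).1 hx₁, ENNReal.toReal_le_of_le_ofReal hb hx₂⟩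
  refine ⟨fun x => (ν.rnDeriv μ x).toReal, ?_, hmeas.ennreal_toReal, ?_, hbd, ?_⟩
  · refine memLp_top_of_bound hmeas.ennreal_toReal.aestronglyMeasurable b ?_
    filter_upwards [hbd] with x hx
    rw [Real.norm_of_nonneg ENNReal.toReal_nonneg]
    exact hx.2
  · rw [Measure.integral_toReal_rnDeriv hac]; simp
  · conv_lhs => rw [← Measure.withDensity_rnDeriv_eq ν μ hac]
    refine withDensity_congr_ae ?_
    filter_upwards [Measure.rnDeriv_ne_top ν μ] with x hx
    rw [ENNReal.ofReal_toReal hx]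

/-! ### The kernel and its truncations -/

theorem IsCompletelyMonotone.nonneg {f : ℝ → ℝ} (hf : IsCompletelyMonotone f) {t : ℝ}
    (ht : 0 < t) : 0 ≤ f t := by
  simpa using hf.2 0 t ht

theorem IsCompletelyMonotone.antitoneOn {f : ℝ → ℝ} (hf : IsCompletelyMonotone f) :
    AntitoneOn f (Ioi 0) := by
  refine antitoneOn_of_deriv_nonpos (convex_Ioi 0) hf.1.continuousOn ?_ fun t ht => ?_
  · rw [interior_Ioi]; exact hf.1.differentiableOn (by simp)
  · rw [interior_Ioi] at ht
    have h := hf.2 1 t ht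
    rw [iteratedDerivWithin_one, derivWithin_of_isOpen isOpen_Ioi ht] at h
    linarith

variable {α : Type*} [PseudoMetricSpace α]

/-- The kernel `k(x,y) = f(|x-y|)`, as an extended nonnegative number. -/
noncomputable def kernel (f : ℝ → ℝ) (q : α × α) : ℝ≥0∞ := ENNReal.ofReal (f (dist q.1 q.2))

/-- The kernel with distances below `ε` replaced by `ε`. -/
noncomputable def cutKernel (f : ℝ → ℝ) (ε : ℝ) (q : α × α) : ℝ≥0∞ := ENNReal.ofReal (f (max ε (dist q.1 q.2)))

theorem cutKernel_le_kernel {f : ℝ → ℝ} (hf : IsCompletelyMonotone f) {ε : ℝ} {q : α × α}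
    (hq : 0 < dist q.1 q.2) : cutKernel f ε q ≤ kernel f q :=
  ENNReal.ofReal_le_ofReal (hf.antitoneOn hq (lt_max_of_lt_right hq) (le_max_right _ _))

theorem cutKernel_eq_kernel {f : ℝ → ℝ} {ε : ℝ} {q : α × α} (hq : ε ≤ dist q.1 q.2) :
    cutKernel f ε q = kernel f q := by
  rw [cutKernel, kernel, max_eq_right hq]

theorem continuous_comp_max_dist {f : ℝ → ℝ} (hf : IsCompletelyMonotone f) {ε : ℝ} (hε : 0 < ε) :
    Continuous fun q : α × α => f (max ε (dist q.1 q.2)) :=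
  hf.1.continuousOn.comp_continuous (by fun_prop) fun _ => lt_max_of_lt_left hε

/-- Since f is nonnegative and nonincreasing, every value lies in [0, f ε]; hence f ε bounds the
distance between any two values. -/
theorem exists_boundedContinuous_cutKernel {f : ℝ → ℝ} (hf : IsCompletelyMonotone f) {ε : ℝ}
    (hε : 0 < ε) :
    ∃ g : BoundedContinuousFunction (α × α) NNReal, ∀ q, (g q : ℝ≥0∞) = cutKernel f ε q := by
  refine ⟨BoundedContinuousFunction.mkOfBound
    ⟨fun q => (f (max ε (dist q.1 q.2))).toNNReal, 
      continuous_real_toNNReal.comp (continuous_comp_max_dist hf hε)⟩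
    (f ε) fun x y => ?_, fun q => rfl⟩
  have h : ∀ q : α × α, 0 ≤ f (max ε (dist q.1 q.2)) ∧ f (max ε (dist q.1 q.2)) ≤ f ε := fun q =>
    ⟨hf.nonneg (lt_max_of_lt_left hε),
      hf.antitoneOn hε (lt_max_of_lt_left hε) (le_max_left _ _)⟩
  rw [NNReal.dist_eq]
  simp only [ContinuousMap.coe_mk, Real.coe_toNNReal _ (h x).1, Real.coe_toNNReal _ (h y).1]
  rw [abs_le]
  constructor <;> linarith [(h x).1, (h x).2, (h y).1, (h y).2]

theorem measurable_cutKernel [MeasurableSpace α] [OpensMeasurableSpace (α × α)] {f : ℝ → ℝ}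
    (hf : IsCompletelyMonotone f) {ε : ℝ} (hε : 0 < ε) :
    Measurable (cutKernel f ε : α × α → ℝ≥0∞) :=
  (continuous_comp_max_dist hf hε).measurable.ennreal_ofReal

/-! ### Empirical measures and energies -/

theorem lintegral_empirical_prod {p n : ℕ} (X : Fin n → EuclideanSpace ℝ (Fin p))
    {F : EuclideanSpace ℝ (Fin p) × EuclideanSpace ℝ (Fin p) → ℝ≥0∞} (hF : Measurable F) :
    ∫⁻ q, F q ∂((empirical n X : Measure (EuclideanSpace ℝ (Fin p))).prod
      (empirical n X : Measure (EuclideanSpace ℝ (Fin p)))) =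
      (n : ℝ≥0∞)⁻¹ ^ 2 * ∑ q : Fin n × Fin n, F (X q.1, X q.2) := by
  have h : ∀ G : EuclideanSpace ℝ (Fin p) → ℝ≥0∞, Measurable G →
      ∫⁻ x, G x ∂(empirical n X : Measure (EuclideanSpace ℝ (Fin p))) =
        (n : ℝ≥0∞)⁻¹ * ∑ i, G (X i) := by
    intro G hG
    change ∫⁻ x, G x ∂((n : ℝ≥0∞)⁻¹ • ∑ j, Measure.dirac (X j)) = _
    rw [lintegral_smul_measure, lintegral_finsetSum_measure]
    simp only [lintegral_dirac' _ hG, smul_eq_mul]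
  rw [lintegral_prod _ hF.aemeasurable, h _ hF.lintegral_prod_right']
  have h' : ∀ x, ∫⁻ y, F (x, y) ∂(empirical n X : Measure (EuclideanSpace ℝ (Fin p))) =
      (n : ℝ≥0∞)⁻¹ * ∑ i, F (x, X i) := fun x => h _ (hF.comp measurable_prodMk_left)
  simp only [h']
  rw [← Finset.mul_sum, ← mul_assoc, ← sq, Fintype.sum_prod_type]

theorem tendsto_lintegral_empirical_prod {p : ℕ} {ψ : ℕ → ℕ} (hψ1 : ∀ m, 1 ≤ ψ m)
    {Y : (n : ℕ) → Fin n → EuclideanSpace ℝ (Fin p)}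
    {ν : FiniteMeasure (EuclideanSpace ℝ (Fin p))}
    (hν : Tendsto (fun m => empirical (ψ m) (Y (ψ m))) atTop (𝓝 ν))
    {f : ℝ → ℝ} (hf : IsCompletelyMonotone f) {ε : ℝ} (hε : 0 < ε) :
    Tendsto (fun m => ((ψ m : ℕ) : ℝ≥0∞)⁻¹ ^ 2 *
        ∑ q : Fin (ψ m) × Fin (ψ m), cutKernel f ε (Y (ψ m) q.1, Y (ψ m) q.2)) atTop
      (𝓝 (∫⁻ q, cutKernel f ε q ∂((ν : Measure (EuclideanSpace ℝ (Fin p))).prod ν))) := by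
  obtain ⟨P, Q, hP, hQ, hPQ⟩ := exists_tendsto_probabilityMeasure
    (fun m => isProbabilityMeasure_empirical (hψ1 m) (Y (ψ m))) hν
  have h₁ : Tendsto (fun m => (P m).prod (P m)) atTop (𝓝 (Q.prod Q)) :=
    (ProbabilityMeasure.continuous_prod.tendsto (Q, Q)).comp (hPQ.prodMk_nhds hPQ)
  obtain ⟨g, hg⟩ := exists_boundedContinuous_cutKernel (α := EuclideanSpace ℝ (Fin p)) hf hε
  have h₂ := ProbabilityMeasure.tendsto_iff_forall_lintegral_tendsto.1 h₁ g
  simp only [hg, ProbabilityMeasure.toMeasure_prod, hP, hQ] at h₂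
  refine h₂.congr fun m => ?_
  exact lintegral_empirical_prod _ (measurable_cutKernel hf hε)

theorem sum_kernel_eq {p n : ℕ} {f : ℝ → ℝ} (hf : IsCompletelyMonotone f)
    {X : Fin n → EuclideanSpace ℝ (Fin p)} (hX : ∀ i j, i ≠ j → 0 < dist (X i) (X j)) :
    ∑ q ∈ Finset.univ.offDiag, kernel f (X q.1, X q.2) =
      ENNReal.ofReal (∑ q ∈ Finset.univ.offDiag, f (dist (X q.1) (X q.2))) := by
  rw [ENNReal.ofReal_sum_of_nonneg fun q hq => ?_]
  · rfl
  · exact hf.nonneg (hX _ _ (Finset.mem_offDiag.1 hq).2.2)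

theorem IsAdmissible.dist_pos {p d n : ℕ} {Ω : Set (EuclideanSpace ℝ (Fin p))} {r R : ℝ}
    (hr : 0 < r) (hn : 1 ≤ n) {X : Fin n → EuclideanSpace ℝ (Fin p)}
    (hX : IsAdmissible d Ω r R n X) {i j : Fin n} (hij : i ≠ j) : 0 < dist (X i) (X j) :=
  (scale_pos hn hr).trans_le (hX.2.1 i j hij)

theorem IsOptimalConfig.sum_kernel_le {p d n : ℕ} {Ω : Set (EuclideanSpace ℝ (Fin p))}
    {r R : ℝ} (hr : 0 < r) (hn : 1 ≤ n) {f : ℝ → ℝ} (hf : IsCompletelyMonotone f)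
    {X X' : Fin n → EuclideanSpace ℝ (Fin p)} (hX : IsOptimalConfig d Ω r R f n X)
    (hX' : IsAdmissible d Ω r R n X') :
    ∑ q ∈ Finset.univ.offDiag, kernel f (X' q.1, X' q.2) ≤
      ∑ q ∈ Finset.univ.offDiag, kernel f (X q.1, X q.2) := by
  rw [sum_kernel_eq hf fun i j hij => hX'.dist_pos hr hn hij,
    sum_kernel_eq hf fun i j hij => hX.1.dist_pos hr hn hij]
  refine ENNReal.ofReal_le_ofReal ?_
  have h := hX.2 X' hX'
  have hn' : (0 : ℝ) < n := by exact_mod_cast hn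
  exact le_of_mul_le_mul_left h (by positivity)

/-- The truncated double sum includes the diagonal, where each of the n terms equals f ε; after
division by n² this is O(1/n). -/
theorem sum_cutKernel_le {p n : ℕ} {f : ℝ → ℝ} (hf : IsCompletelyMonotone f) {ε : ℝ}
    (hε : 0 < ε) {X : Fin n → EuclideanSpace ℝ (Fin p)}
    (hX : ∀ i j, i ≠ j → 0 < dist (X i) (X j)) :
    ∑ q : Fin n × Fin n, cutKernel f ε (X q.1, X q.2) ≤
      n * ENNReal.ofReal (f ε) + ∑ q ∈ Finset.univ.offDiag, kernel f (X q.1, X q.2) := by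
  rw [← Finset.univ_product_univ, ← Finset.diag_union_offDiag,
    Finset.sum_union (Finset.disjoint_diag_offDiag _)]
  refine add_le_add (le_of_eq ?_) (Finset.sum_le_sum fun q hq => ?_)
  · rw [Finset.sum_diag]
    simp [cutKernel, max_eq_left hε.le]
  · exact cutKernel_le_kernel hf (hX _ _ (Finset.mem_offDiag.1 hq).2.2)

theorem sum_kernel_le {p n : ℕ} {f : ℝ → ℝ} {ε : ℝ} {X : Fin n → EuclideanSpace ℝ (Fin p)} :
    ∑ q ∈ Finset.univ.offDiag, kernel f (X q.1, X q.2) ≤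
      ∑ q : Fin n × Fin n, cutKernel f ε (X q.1, X q.2) +
      ∑ q ∈ Finset.univ.offDiag.filter fun q => dist (X q.1) (X q.2) < ε,
        kernel f (X q.1, X q.2) := by
  rw [← Finset.sum_filter_add_sum_filter_not _ (fun q => dist (X q.1) (X q.2) < ε), add_comm]
  refine add_le_add_left ?_ _
  calc _ = ∑ q ∈ Finset.univ.offDiag.filter fun q => ¬ dist (X q.1) (X q.2) < ε,
        cutKernel f ε (X q.1, X q.2) := Finset.sum_congr rfl fun q hq =>
          (cutKernel_eq_kernel (not_lt.1 (Finset.mem_filter.1 hq).2)).symm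
    _ ≤ _ := Finset.sum_le_sum_of_subset (Finset.subset_univ _)

/-! ### Contribution of pairs near the diagonal -/

/-- Points of the two balls are at distance at most dist x y + 2s ≤ dist x y + h, so monotonicity
and the ratio bound give f(dist x y) ≤ C₀ k on the whole product. The condition 2s ≤ dist x y keeps
the product off the diagonal, where monotonicity would say nothing. -/
theorem kernel_mul_le {p d : ℕ} {Ω : Set (EuclideanSpace ℝ (Fin p))}
    [IsFiniteMeasure (surf d Ω)] {f : ℝ → ℝ} (hf : IsCompletelyMonotone f)
    {x y : EuclideanSpace ℝ (Fin p)} {s h C₀ : ℝ} {w : ℝ≥0∞} (hsh : 2 * s ≤ h)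
    (hxy : 2 * s ≤ dist x y)
    (hx : w ≤ surf d Ω (Metric.ball x s)) (hy : w ≤ surf d Ω (Metric.ball y s))
    (hpos : 0 < f (dist x y + h)) (hC : f (dist x y) / f (dist x y + h) ≤ C₀) :
    kernel f (x, y) * w ^ 2 ≤ ENNReal.ofReal C₀ *
      ∫⁻ q in Metric.ball x s ×ˢ Metric.ball y s, kernel f q ∂((surf d Ω).prod (surf d Ω)) := by
  calc kernel f (x, y) * w ^ 2
      ≤ kernel f (x, y) * (surf d Ω (Metric.ball x s) * surf d Ω (Metric.ball y s)) := by
        rw [sq]; gcongr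
    _ = ∫⁻ _q in Metric.ball x s ×ˢ Metric.ball y s, kernel f (x, y)
          ∂((surf d Ω).prod (surf d Ω)) := by
        rw [setLIntegral_const, Measure.prod_prod]
    _ ≤ ∫⁻ q in Metric.ball x s ×ˢ Metric.ball y s, ENNReal.ofReal C₀ * kernel f q
          ∂((surf d Ω).prod (surf d Ω)) := by
        refine setLIntegral_mono' (Metric.isOpen_ball.measurableSet.prod
          Metric.isOpen_ball.measurableSet) fun q hq => ?_
        obtain ⟨h₁, h₂⟩ := hq
        rw [Metric.mem_ball] at h₁ h₂
        have hq1 : dist q.1 q.2 ≤ dist x y + h := by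
          have := dist_triangle4 q.1 x y q.2
          rw [dist_comm y] at this
          linarith
        have hq0 : 0 < dist q.1 q.2 := by
          have := dist_triangle4 x q.1 q.2 y
          rw [dist_comm x q.1] at this
          linarith
        have hle : f (dist x y + h) ≤ f (dist q.1 q.2) :=
          hf.antitoneOn hq0 (hq0.trans_le hq1) hq1
        have hmul : f (dist x y) ≤ C₀ * f (dist x y + h) := (div_le_iff₀ hpos).1 hC
        rw [kernel, kernel]
        calc ENNReal.ofReal (f (dist x y)) ≤ ENNReal.ofReal (C₀ * f (dist x y + h)) :=
              ENNReal.ofReal_le_ofReal hmul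
          _ = ENNReal.ofReal C₀ * ENNReal.ofReal (f (dist x y + h)) := ENNReal.ofReal_mul' hpos.le
          _ ≤ _ := by gcongr
    _ = _ := lintegral_const_mul' _ _ ENNReal.ofReal_ne_top

/-- The energy of the pairs at distance less than `ε` in an admissible configuration is controlled
by the integral of the kernel near the diagonal. -/
theorem sum_near_diagonal_le {p d n : ℕ} (hd : 1 ≤ d) {Ω : Set (EuclideanSpace ℝ (Fin p))}
    [IsFiniteMeasure (surf d Ω)] {c s₀ : ℝ} (hc : 0 < c)
    (hA : ∀ y ∈ Ω, ∀ s, 0 < s → s ≤ s₀ →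
      ENNReal.ofReal (c * s ^ d) ≤ surf d Ω (Metric.ball y s))
    {f : ℝ → ℝ} (hf : IsCompletelyMonotone f) {r R κ C₀ D ε : ℝ} (hκ : 0 < κ) (hκr : 2 * κ ≤ r)
    (hκR : 2 * κ ≤ √2 * R) (hn : 1 ≤ n)
    (hC : ∀ x : ℝ, r * (n : ℝ) ^ (-(1 : ℝ) / d) ≤ x →
      f x / f (x + √2 * R * (n : ℝ) ^ (-(1 : ℝ) / d)) ≤ C₀)
    (hD : ∀ t, 0 < t → t ≤ D → 0 < f t)
    (hs₀ : κ * (n : ℝ) ^ (-(1 : ℝ) / d) ≤ s₀)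
    (hεD : ε + √2 * R * (n : ℝ) ^ (-(1 : ℝ) / d) ≤ D)
    {X : Fin n → EuclideanSpace ℝ (Fin p)} (hX : IsAdmissible d Ω r R n X) :
    (n : ℝ≥0∞)⁻¹ ^ 2 * ∑ q ∈ Finset.univ.offDiag.filter fun q => dist (X q.1) (X q.2) < ε,
        kernel f (X q.1, X q.2) ≤
      ENNReal.ofReal C₀ * (ENNReal.ofReal (c * κ ^ d))⁻¹ ^ 2 *
        ∫⁻ q in {q : EuclideanSpace ℝ (Fin p) × EuclideanSpace ℝ (Fin p) |
          dist q.1 q.2 < ε + √2 * R * (n : ℝ) ^ (-(1 : ℝ) / d)},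
          kernel f q ∂((surf d Ω).prod (surf d Ω)) := by
  have hnpos : (0 : ℝ) < n := by exact_mod_cast hn
  set a : ℝ := (n : ℝ) ^ (-(1 : ℝ) / d) with ha
  have hapos : 0 < a := by positivity
  set s : ℝ := κ * a with hs
  have hspos : 0 < s := by positivity
  set h : ℝ := √2 * R * a with hh
  have h2s : 2 * s ≤ h := by rw [hs, hh]; nlinarith
  have hsr : 2 * s ≤ r * a := by rw [hs]; nlinarith
  set w : ℝ≥0∞ := ENNReal.ofReal (c * κ ^ d) with hw
  have hw0 : w ≠ 0 := by rw [hw]; simp; positivity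
  have hwtop : w ≠ ⊤ := ENNReal.ofReal_ne_top
  have hwn : w * (n : ℝ≥0∞)⁻¹ = ENNReal.ofReal (c * s ^ d) := by
    rw [hw, hs, ha, scale_pow hd, ← ENNReal.ofReal_natCast n, ← ENNReal.ofReal_inv_of_pos hnpos,
      ← ENNReal.ofReal_mul (by positivity)]
    congr 1
    field_simp
  set S := Finset.univ.offDiag.filter fun q : Fin n × Fin n => dist (X q.1) (X q.2) < ε with hS
  set B : Fin n × Fin n → Set (EuclideanSpace ℝ (Fin p) × EuclideanSpace ℝ (Fin p)) := fun q =>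
    Metric.ball (X q.1) s ×ˢ Metric.ball (X q.2) s with hB
  have hdisj : ∀ i j, i ≠ j → Disjoint (Metric.ball (X i) s) (Metric.ball (X j) s) :=
    fun i j hij => Metric.ball_disjoint_ball (by linarith [hX.2.1 i j hij])
  have hterm : ∀ q ∈ S, kernel f (X q.1, X q.2) * (w * (n : ℝ≥0∞)⁻¹) ^ 2 ≤
      ENNReal.ofReal C₀ * ∫⁻ z in B q, kernel f z ∂((surf d Ω).prod (surf d Ω)) := by
    intro q hq
    obtain ⟨hq1, hq2⟩ := Finset.mem_filter.1 hq
    have hne := (Finset.mem_offDiag.1 hq1).2.2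
    have hr' := hX.2.1 _ _ hne
    have hdpos : 0 < dist (X q.1) (X q.2) := by linarith
    rw [hwn]
    exact kernel_mul_le hf h2s (hsr.trans hr') (hA _ (hX.1 _) s hspos hs₀)
      (hA _ (hX.1 _) s hspos hs₀) (hD _ (by linarith) (by linarith)) (hC _ hr')
  have hsum : (∑ q ∈ S, kernel f (X q.1, X q.2)) * (w * (n : ℝ≥0∞)⁻¹) ^ 2 ≤
      ENNReal.ofReal C₀ * ∫⁻ q in {q : EuclideanSpace ℝ (Fin p) × EuclideanSpace ℝ (Fin p) |
          dist q.1 q.2 < ε + h}, kernel f q ∂((surf d Ω).prod (surf d Ω)) := by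
    rw [Finset.sum_mul]
    refine (Finset.sum_le_sum hterm).trans ?_
    -- Distinct pairs differ in some coordinate, and the balls about distinct points are disjoint,
    -- so the products are disjoint and the integrals add up.
    rw [← Finset.mul_sum, ← lintegral_biUnion_finset]
    · gcongr
      refine iUnion₂_subset fun q hq z hz => ?_
      obtain ⟨h₁, h₂⟩ := hz
      rw [Metric.mem_ball] at h₁ h₂
      have h₃ := (Finset.mem_filter.1 hq).2
      have := dist_triangle4 z.1 (X q.1) (X q.2) z.2
      rw [dist_comm (X q.2)] at this
      change dist z.1 z.2 < ε + h
      linarith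
    · intro q _ q' _ hqq
      refine disjoint_prod.2 ?_
      by_cases h1 : q.1 = q'.1
      · exact Or.inr (hdisj _ _ fun h2 => hqq (Prod.ext h1 h2))
      · exact Or.inl (hdisj _ _ h1)
    · exact fun q _ => Metric.isOpen_ball.measurableSet.prod Metric.isOpen_ball.measurableSet
  calc _ = w⁻¹ ^ 2 * ((∑ q ∈ S, kernel f (X q.1, X q.2)) * (w * (n : ℝ≥0∞)⁻¹) ^ 2) := by
        have : w⁻¹ ^ 2 * w ^ 2 = 1 := by rw [← mul_pow, ENNReal.inv_mul_cancel hw0 hwtop, one_pow]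
        calc _ = (w⁻¹ ^ 2 * w ^ 2) * ((n : ℝ≥0∞)⁻¹ ^ 2 * ∑ q ∈ S, kernel f (X q.1, X q.2)) := by
              rw [this, one_mul]
          _ = _ := by rw [mul_pow]; ring
    _ ≤ w⁻¹ ^ 2 * _ := mul_le_mul_right hsum _
    _ = _ := by ring

theorem surf_singleton {p d : ℕ} (hd : 1 ≤ d) (Ω : Set (EuclideanSpace ℝ (Fin p)))
    (x : EuclideanSpace ℝ (Fin p)) : surf d Ω {x} = 0 := by
  have := Measure.nullSingletonClass_hausdorff (EuclideanSpace ℝ (Fin p))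
    (d := (d : ℝ)) (by positivity)
  refine le_antisymm ((Measure.restrict_apply_le _ _).trans ?_) zero_le
  rw [Measure.euclideanHausdorffMeasure_def]
  simp

theorem prod_surf_diagonal {p d : ℕ} (hd : 1 ≤ d) (Ω : Set (EuclideanSpace ℝ (Fin p)))
    [IsFiniteMeasure (surf d Ω)] :
    ((surf d Ω).prod (surf d Ω)) {q | dist q.1 q.2 = 0} = 0 := by
  rw [Measure.measure_prod_null (measurableSet_eq_fun (by fun_prop) (by fun_prop))]
  refine Eventually.of_forall fun x => ?_
  have : (Prod.mk x ⁻¹' {q : EuclideanSpace ℝ (Fin p) × EuclideanSpace ℝ (Fin p) |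
      dist q.1 q.2 = 0}) = {x} := by
    ext y; simp [eq_comm]
  simp only [this, surf_singleton hd, Pi.zero_apply]

/-- Absolute continuity of the integral: the strips shrink to the diagonal, which is null because
points are null when d ≥ 1. -/
theorem tendsto_lintegral_near_diagonal {p d : ℕ} (hd : 1 ≤ d)
    (Ω : Set (EuclideanSpace ℝ (Fin p))) [IsFiniteMeasure (surf d Ω)] {f : ℝ → ℝ}
    (hfin : ∫⁻ q, kernel f q ∂((surf d Ω).prod (surf d Ω)) ≠ ⊤) :
    Tendsto (fun η : ℝ => ∫⁻ q in {q : EuclideanSpace ℝ (Fin p) × EuclideanSpace ℝ (Fin p) |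
      dist q.1 q.2 < η}, kernel f q ∂((surf d Ω).prod (surf d Ω))) (𝓝[>] 0) (𝓝 0) := by
  refine tendsto_setLIntegral_zero hfin ?_
  have h := tendsto_measure_biInter_gt (μ := (surf d Ω).prod (surf d Ω)) (a := (0 : ℝ))
    (s := fun η : ℝ => {q : EuclideanSpace ℝ (Fin p) × EuclideanSpace ℝ (Fin p) |
      dist q.1 q.2 < η})
    (fun η _ => (measurableSet_lt (by fun_prop) (by fun_prop)).nullMeasurableSet)
    (fun i j _ hij q hq => lt_of_lt_of_le hq hij) ⟨1, one_pos, measure_ne_top _ _⟩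
  have heq : (⋂ η : ℝ, ⋂ (_ : η > 0), {q : EuclideanSpace ℝ (Fin p) × EuclideanSpace ℝ (Fin p) |
      dist q.1 q.2 < η}) = {q | dist q.1 q.2 = 0} := by
    ext q
    simp only [mem_iInter, mem_ofPred_eq]
    exact ⟨fun h => le_antisymm (le_of_forall_gt fun η hη => h η hη) dist_nonneg,
      fun h η hη => h ▸ hη⟩
  rw [heq, prod_surf_diagonal hd] at h
  exact h

/-! ### Comparison of the limiting energies -/

theorem ae_prod_dist_pos {p d : ℕ} (hd : 1 ≤ d) {Ω : Set (EuclideanSpace ℝ (Fin p))}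
    [IsFiniteMeasure (surf d Ω)] {ν : FiniteMeasure (EuclideanSpace ℝ (Fin p))}
    (hν : (ν : Measure (EuclideanSpace ℝ (Fin p))) ≪ surf d Ω) :
    ∀ᵐ q ∂((ν : Measure (EuclideanSpace ℝ (Fin p))).prod
      (ν : Measure (EuclideanSpace ℝ (Fin p)))), 0 < dist q.1 q.2 := by
  have h : ∀ᵐ q ∂((surf d Ω).prod (surf d Ω)), 0 < dist q.1 q.2 := by
    rw [ae_iff]
    have heq : {q : EuclideanSpace ℝ (Fin p) × EuclideanSpace ℝ (Fin p) | ¬ 0 < dist q.1 q.2} =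
        {q | dist q.1 q.2 = 0} := by
      ext q
      simp only [mem_ofPred_eq, not_lt]
      exact ⟨fun h => le_antisymm h dist_nonneg, fun h => h.le⟩
    rw [heq, prod_surf_diagonal hd]
  exact (hν.prod hν).ae_le h

/-- Chain for fixed n: truncated energy of X', energy of X', energy of X by optimality, truncated
energy of X plus the near-diagonal pairs. Then n → ∞ with ε fixed. -/
theorem lintegral_cutKernel_le {p d : ℕ} (hd : 1 ≤ d) {Ω : Set (EuclideanSpace ℝ (Fin p))}
    [IsFiniteMeasure (surf d Ω)] {c s₀ : ℝ} (hc : 0 < c) (hs₀ : 0 < s₀)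
    (hA : ∀ y ∈ Ω, ∀ s, 0 < s → s ≤ s₀ →
      ENNReal.ofReal (c * s ^ d) ≤ surf d Ω (Metric.ball y s))
    {f : ℝ → ℝ} (hf : IsCompletelyMonotone f)
    {r R κ C₀ D ε : ℝ} (hr : 0 < r) (hκ : 0 < κ) (hκr : 2 * κ ≤ r)
    (hκR : 2 * κ ≤ √2 * R) (hε : 0 < ε) (hεD : 2 * ε ≤ D)
    (hC : ∀ n : ℕ, 1 ≤ n → ∀ x : ℝ, r * (n : ℝ) ^ (-(1 : ℝ) / d) ≤ x →
      f x / f (x + √2 * R * (n : ℝ) ^ (-(1 : ℝ) / d)) ≤ C₀)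
    (hD : ∀ t, 0 < t → t ≤ D → 0 < f t)
    {ψ : ℕ → ℕ} (hψ : Tendsto ψ atTop atTop) (hψ1 : ∀ m, 1 ≤ ψ m)
    {X X' : (n : ℕ) → Fin n → EuclideanSpace ℝ (Fin p)}
    (hX : ∀ m, IsOptimalConfig d Ω r R f (ψ m) (X (ψ m)))
    (hX' : ∀ m, IsAdmissible d Ω r R (ψ m) (X' (ψ m)))
    {ν ν' : FiniteMeasure (EuclideanSpace ℝ (Fin p))}
    (hν : Tendsto (fun m => empirical (ψ m) (X (ψ m))) atTop (𝓝 ν))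
    (hν' : Tendsto (fun m => empirical (ψ m) (X' (ψ m))) atTop (𝓝 ν')) :
    ∫⁻ q, cutKernel f ε q ∂((ν' : Measure (EuclideanSpace ℝ (Fin p))).prod ν') ≤
      ∫⁻ q, cutKernel f ε q ∂((ν : Measure (EuclideanSpace ℝ (Fin p))).prod ν) +
      ENNReal.ofReal C₀ * (ENNReal.ofReal (c * κ ^ d))⁻¹ ^ 2 *
        ∫⁻ q in {q : EuclideanSpace ℝ (Fin p) × EuclideanSpace ℝ (Fin p) |
          dist q.1 q.2 < 2 * ε}, kernel f q ∂((surf d Ω).prod (surf d Ω)) := by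
  set J := ENNReal.ofReal C₀ * (ENNReal.ofReal (c * κ ^ d))⁻¹ ^ 2 *
        ∫⁻ q in {q : EuclideanSpace ℝ (Fin p) × EuclideanSpace ℝ (Fin p) |
          dist q.1 q.2 < 2 * ε}, kernel f q ∂((surf d Ω).prod (surf d Ω)) with hJ
  have hdiag : Tendsto (fun m => ((ψ m : ℕ) : ℝ≥0∞)⁻¹ * ENNReal.ofReal (f ε)) atTop (𝓝 0) := by
    have := ENNReal.Tendsto.mul_const (b := ENNReal.ofReal (f ε))
      (ENNReal.tendsto_inv_nat_nhds_zero.comp hψ) (Or.inr ENNReal.ofReal_ne_top)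
    simpa using this
  have hlim := ((tendsto_lintegral_empirical_prod hψ1 hν hf hε).add
    (tendsto_const_nhds (x := J))).add hdiag
  rw [add_zero] at hlim
  refine le_of_tendsto_of_tendsto (tendsto_lintegral_empirical_prod hψ1 hν' hf hε) hlim ?_
  have hev₁ := (tendsto_scale_nhds_zero hd hψ (a := κ)).eventually (gt_mem_nhds hs₀)
  -- Once √2 R n^(-1/d) < ε, the strip of width ε + √2 R n^(-1/d) lies in the fixed strip of width
  -- 2ε.
  have hev₂ := (tendsto_scale_nhds_zero hd hψ (a := √2 * R)).eventually (gt_mem_nhds hε)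
  filter_upwards [hev₁, hev₂] with m h₁ h₂
  have hn := hψ1 m
  have hn0 : ((ψ m : ℕ) : ℝ≥0∞) ≠ 0 := by simp; omega
  have hn2 : ((ψ m : ℕ) : ℝ≥0∞)⁻¹ ^ 2 * ψ m = ((ψ m : ℕ) : ℝ≥0∞)⁻¹ := by
    rw [sq, mul_assoc, ENNReal.inv_mul_cancel hn0 (by simp), mul_one]
  have hnear := sum_near_diagonal_le hd hc hA hf hκ hκr hκR hn (hC _ hn) hD h₁.le
    (ε := ε) (by linarith) (hX m).1
  have hnearJ : ENNReal.ofReal C₀ * (ENNReal.ofReal (c * κ ^ d))⁻¹ ^ 2 *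
        ∫⁻ q in {q : EuclideanSpace ℝ (Fin p) × EuclideanSpace ℝ (Fin p) |
          dist q.1 q.2 < ε + √2 * R * (ψ m : ℝ) ^ (-(1 : ℝ) / d)},
          kernel f q ∂((surf d Ω).prod (surf d Ω)) ≤ J := by
    rw [hJ]
    gcongr
    linarith
  set A : ℝ≥0∞ := ((ψ m : ℕ) : ℝ≥0∞)⁻¹ ^ 2 with hAdef
  calc A * ∑ q : Fin (ψ m) × Fin (ψ m), cutKernel f ε (X' (ψ m) q.1, X' (ψ m) q.2)
      ≤ A * (ψ m * ENNReal.ofReal (f ε) +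
          ∑ q ∈ Finset.univ.offDiag, kernel f (X' (ψ m) q.1, X' (ψ m) q.2)) := by
        gcongr
        exact sum_cutKernel_le hf hε fun i j hij => (hX' m).dist_pos hr hn hij
    _ ≤ A * (ψ m * ENNReal.ofReal (f ε) +
          ∑ q ∈ Finset.univ.offDiag, kernel f (X (ψ m) q.1, X (ψ m) q.2)) := by
        gcongr A * (_ + ?_)
        exact (hX m).sum_kernel_le hr hn hf (hX' m)
    _ ≤ A * (ψ m * ENNReal.ofReal (f ε) +
          (∑ q : Fin (ψ m) × Fin (ψ m), cutKernel f ε (X (ψ m) q.1, X (ψ m) q.2) +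
          ∑ q ∈ Finset.univ.offDiag.filter fun q => dist (X (ψ m) q.1) (X (ψ m) q.2) < ε,
            kernel f (X (ψ m) q.1, X (ψ m) q.2))) := by
        gcongr
        exact sum_kernel_le
    _ = A * ∑ q : Fin (ψ m) × Fin (ψ m), cutKernel f ε (X (ψ m) q.1, X (ψ m) q.2) +
          A * (∑ q ∈ Finset.univ.offDiag.filter fun q => dist (X (ψ m) q.1) (X (ψ m) q.2) < ε,
            kernel f (X (ψ m) q.1, X (ψ m) q.2)) + A * ψ m * ENNReal.ofReal (f ε) := by ring
    _ ≤ _ := by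
        rw [hn2]
        gcongr
        exact hnear.trans hnearJ

/-- The truncation is removed by Fatou for ν' and by domination by the kernel for ν. Both measures
are absolutely continuous, so the diagonal is negligible. -/
theorem lintegral_kernel_le {p d : ℕ} (hd : 1 ≤ d) {Ω : Set (EuclideanSpace ℝ (Fin p))}
    [IsFiniteMeasure (surf d Ω)] {f : ℝ → ℝ} (hf : IsCompletelyMonotone f)
    (hfin : ∫⁻ q, kernel f q ∂((surf d Ω).prod (surf d Ω)) ≠ ⊤) {C : ℝ≥0∞} (hC : C ≠ ⊤) {D : ℝ}
    (hD : 0 < D) {ν ν' : FiniteMeasure (EuclideanSpace ℝ (Fin p))}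
    (hν : (ν : Measure (EuclideanSpace ℝ (Fin p))) ≪ surf d Ω)
    (hν' : (ν' : Measure (EuclideanSpace ℝ (Fin p))) ≪ surf d Ω)
    (h : ∀ ε, 0 < ε → 2 * ε ≤ D →
      ∫⁻ q, cutKernel f ε q ∂((ν' : Measure (EuclideanSpace ℝ (Fin p))).prod ν') ≤
      ∫⁻ q, cutKernel f ε q ∂((ν : Measure (EuclideanSpace ℝ (Fin p))).prod ν) +
      C * ∫⁻ q in {q : EuclideanSpace ℝ (Fin p) × EuclideanSpace ℝ (Fin p) |
          dist q.1 q.2 < 2 * ε}, kernel f q ∂((surf d Ω).prod (surf d Ω))) :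
    ∫⁻ q, kernel f q ∂((ν' : Measure (EuclideanSpace ℝ (Fin p))).prod ν') ≤
      ∫⁻ q, kernel f q ∂((ν : Measure (EuclideanSpace ℝ (Fin p))).prod ν) := by
  set ε : ℕ → ℝ := fun j => D / 2 * (1 / ((j : ℝ) + 1)) with hε
  have hεpos : ∀ j, 0 < ε j := fun j => by positivity
  have hεD : ∀ j, 2 * ε j ≤ D := fun j => by
    have : 1 / ((j : ℝ) + 1) ≤ 1 := by
      rw [div_le_one (by positivity)]; linarith [(Nat.cast_nonneg j : (0 : ℝ) ≤ j)]
    simp only [hε]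
    nlinarith
  have hε0 : Tendsto ε atTop (𝓝 0) := by
    simpa [hε] using (tendsto_one_div_add_atTop_nhds_zero_nat (𝕜 := ℝ)).const_mul (D / 2)
  have h2ε : Tendsto (fun j => 2 * ε j) atTop (𝓝[>] 0) :=
    tendsto_nhdsWithin_iff.2 ⟨by simpa using hε0.const_mul 2,
      Eventually.of_forall fun j => mul_pos two_pos (hεpos j)⟩
  have hJ := ENNReal.Tendsto.const_mul (a := C)
    ((tendsto_lintegral_near_diagonal hd Ω hfin).comp h2ε) (Or.inr hC)
  rw [mul_zero] at hJ
  have hlim := (tendsto_const_nhds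
    (x := ∫⁻ q, kernel f q ∂((ν : Measure (EuclideanSpace ℝ (Fin p))).prod
      (ν : Measure (EuclideanSpace ℝ (Fin p)))))).add hJ
  rw [add_zero] at hlim
  calc ∫⁻ q, kernel f q ∂((ν' : Measure (EuclideanSpace ℝ (Fin p))).prod ν')
      = ∫⁻ q, liminf (fun j => cutKernel f (ε j) q) atTop
          ∂((ν' : Measure (EuclideanSpace ℝ (Fin p))).prod ν') := by
        refine lintegral_congr_ae ?_
        filter_upwards [ae_prod_dist_pos hd hν'] with q hq
        refine (Tendsto.liminf_eq (tendsto_const_nhds.congr' ?_)).symm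
        filter_upwards [hε0.eventually (gt_mem_nhds hq)] with j hj
        exact (cutKernel_eq_kernel hj.le).symm
    _ ≤ liminf (fun j => ∫⁻ q, cutKernel f (ε j) q
          ∂((ν' : Measure (EuclideanSpace ℝ (Fin p))).prod ν')) atTop :=
        lintegral_liminf_le fun j => measurable_cutKernel hf (hεpos j)
    _ ≤ liminf (fun j => ∫⁻ q, kernel f q ∂((ν : Measure (EuclideanSpace ℝ (Fin p))).prod
          (ν : Measure (EuclideanSpace ℝ (Fin p)))) +
          C * ∫⁻ q in {q : EuclideanSpace ℝ (Fin p) × EuclideanSpace ℝ (Fin p) |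
          dist q.1 q.2 < 2 * ε j}, kernel f q ∂((surf d Ω).prod (surf d Ω))) atTop := by
        refine liminf_le_liminf (Eventually.of_forall fun j => (h _ (hεpos j) (hεD j)).trans ?_)
        gcongr ?_ + _
        refine lintegral_mono_ae ?_
        filter_upwards [ae_prod_dist_pos hd hν] with q hq
        exact cutKernel_le_kernel hf hq
    _ = _ := hlim.liminf_eq

/-- The energy of an admissible density in terms of the measure it defines. -/
theorem densityEnergy_eq {p d : ℕ} (hd : 1 ≤ d) {Ω : Set (EuclideanSpace ℝ (Fin p))}
    [IsFiniteMeasure (surf d Ω)] {f : ℝ → ℝ} (hf : IsCompletelyMonotone f)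
    (hfint : Integrable (fun q : EuclideanSpace ℝ (Fin p) × EuclideanSpace ℝ (Fin p) =>
      f (dist q.1 q.2)) ((surf d Ω).prod (surf d Ω)))
    {ρplus ρminus : ℝ} (hρ : 0 < ρminus) {ρ : EuclideanSpace ℝ (Fin p) → ℝ}
    (hadm : IsAdmissibleDensity d Ω ρplus ρminus ρ)
    {ν : FiniteMeasure (EuclideanSpace ℝ (Fin p))} (hν : HasDensity d Ω ν ρ) :
    densityEnergy d Ω f ρ = 1 / 2 *
      (∫⁻ q, kernel f q ∂((ν : Measure (EuclideanSpace ℝ (Fin p))).prod ν)).toReal ∧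
    ∫⁻ q, kernel f q ∂((ν : Measure (EuclideanSpace ℝ (Fin p))).prod ν) ≠ ⊤ := by
  obtain ⟨hmem, -, hbd⟩ := hadm
  have hρm : AEStronglyMeasurable ρ (surf d Ω) := hmem.1
  have hρ1 : AEMeasurable (fun x => ENNReal.ofReal (ρ x)) (surf d Ω) :=
    hρm.aemeasurable.ennreal_ofReal
  have hbd1 : ∀ᵐ q ∂((surf d Ω).prod (surf d Ω)), ρminus ≤ ρ q.1 ∧ ρ q.1 ≤ ρplus :=
    Measure.quasiMeasurePreserving_fst.ae hbd
  have hbd2 : ∀ᵐ q ∂((surf d Ω).prod (surf d Ω)), ρminus ≤ ρ q.2 ∧ ρ q.2 ≤ ρplus :=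
    Measure.quasiMeasurePreserving_snd.ae hbd
  have hpos : ∀ᵐ q ∂((surf d Ω).prod (surf d Ω)), 0 < dist q.1 q.2 := by
    have := ae_prod_dist_pos hd (Ω := Ω)
      (ν := (⟨surf d Ω, inferInstance⟩ : FiniteMeasure (EuclideanSpace ℝ (Fin p))))
      Measure.AbsolutelyContinuous.rfl
    exact this
  have heq : ∫⁻ q, kernel f q ∂((ν : Measure (EuclideanSpace ℝ (Fin p))).prod ν) =
      ∫⁻ q, ENNReal.ofReal (f (dist q.1 q.2) * ρ q.1 * ρ q.2)
        ∂((surf d Ω).prod (surf d Ω)) := by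
    have hρ2 : AEMeasurable (fun q : EuclideanSpace ℝ (Fin p) × EuclideanSpace ℝ (Fin p) =>
        ENNReal.ofReal (ρ q.1) * ENNReal.ofReal (ρ q.2)) ((surf d Ω).prod (surf d Ω)) :=
      (hρ1.comp_quasiMeasurePreserving Measure.quasiMeasurePreserving_fst).mul
        (hρ1.comp_quasiMeasurePreserving Measure.quasiMeasurePreserving_snd)
    rw [show (ν : Measure (EuclideanSpace ℝ (Fin p))) = _ from hν, prod_withDensity₀ hρ1 hρ1,
      lintegral_withDensity_eq_lintegral_mul₀ hρ2
        (show AEMeasurable (kernel f) _ from hfint.1.aemeasurable.ennreal_ofReal)]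
    refine lintegral_congr_ae ?_
    filter_upwards [hbd1, hbd2, hpos] with q h₁ h₂ h₃
    have hf0 := hf.nonneg h₃
    have h₁0 : 0 ≤ ρ q.1 := hρ.le.trans h₁.1
    rw [ENNReal.ofReal_mul (by positivity), ENNReal.ofReal_mul hf0]
    simp only [Pi.mul_apply, kernel]
    ring
  have hmeas : AEStronglyMeasurable (fun q : EuclideanSpace ℝ (Fin p) × EuclideanSpace ℝ (Fin p) =>
      f (dist q.1 q.2) * ρ q.1 * ρ q.2) ((surf d Ω).prod (surf d Ω)) :=
    (hfint.1.mul (hρm.comp_quasiMeasurePreserving Measure.quasiMeasurePreserving_fst)).mul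
      (hρm.comp_quasiMeasurePreserving Measure.quasiMeasurePreserving_snd)
  rw [heq]
  refine ⟨?_, ?_⟩
  · rw [densityEnergy, integral_eq_lintegral_of_nonneg_ae ?_ hmeas]
    filter_upwards [hbd1, hbd2, hpos] with q h₁ h₂ h₃
    have hf0 := hf.nonneg h₃
    have h₁0 : 0 ≤ ρ q.1 := hρ.le.trans h₁.1
    have h₂0 : 0 ≤ ρ q.2 := hρ.le.trans h₂.1
    simp only [Pi.zero_apply]
    positivity
  -- The integrand is dominated by ρplus² times the integrable kernel.
  · have hint : Integrable (fun q : EuclideanSpace ℝ (Fin p) × EuclideanSpace ℝ (Fin p) =>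
        f (dist q.1 q.2) * ρ q.1 * ρ q.2) ((surf d Ω).prod (surf d Ω)) := by
      refine (hfint.mul_const (ρplus ^ 2)).mono' hmeas ?_
      filter_upwards [hbd1, hbd2, hpos] with q h₁ h₂ h₃
      have hf0 := hf.nonneg h₃
      have h₁0 : 0 ≤ ρ q.1 := hρ.le.trans h₁.1
      have h₂0 : 0 ≤ ρ q.2 := hρ.le.trans h₂.1
      rw [Real.norm_of_nonneg (by positivity), sq, ← mul_assoc]
      have hρ0 : 0 ≤ ρplus := h₁0.trans h₁.2
      exact mul_le_mul (mul_le_mul_of_nonneg_left h₁.2 hf0) h₂.2 h₂0 (by positivity)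
    exact hint.lintegral_lt_top.ne

end PointConfig

/-! ### Extremality of the weak-* limits -/

theorem corollary4p3 (p d : ℕ) (hd : 1 ≤ d) (hdp : d ≤ p)
    (Ω : Set (EuclideanSpace ℝ (Fin p))) (hΩc : IsCompact Ω)
    (hΩpos : 0 < PointConfig.surf d Ω univ) (hΩfin : PointConfig.surf d Ω univ < ⊤)
    (hΩman : PointConfig.IsSmoothSubmanifold d Ω)
    (hΩbasis : PointConfig.HasRegularBasis d Ω)
    (hΩeuc : PointConfig.IsEuclideanType d Ω)
    -- the kernel `k(x,y) = f(|x-y|)`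
    (f : ℝ → ℝ) (hf : PointConfig.IsCompletelyMonotone f)
    (hfpos : ∀ x ∈ Ω, ∀ y ∈ Ω, x ≠ y → 0 < f (dist x y))
    (hfint : Integrable (fun q : EuclideanSpace ℝ (Fin p) × EuclideanSpace ℝ (Fin p) =>
      f (dist q.1 q.2)) ((PointConfig.surf d Ω).prod (PointConfig.surf d Ω)))
    -- the constants
    (r R ρplus ρminus : ℝ) (hr : 0 < r) (hR : 0 < R)
    (hρplus : (PointConfig.surf d Ω univ).toReal⁻¹ ≤ ρplus)
    (hρminus : ρminus ≤ (PointConfig.surf d Ω univ).toReal⁻¹) (hρpos : 0 < ρminus)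
    (hpack : 2 ^ d * PointConfig.packingDensity d ≤
      ENNReal.ofReal (ρplus * r ^ d * PointConfig.ballVol d))
    (hcover : ENNReal.ofReal (ρminus * R ^ d * PointConfig.ballVol d) ≤
      PointConfig.coveringDensity d)
    (hC : ∃ C₀ : ℝ, ∀ n : ℕ, 1 ≤ n → ∀ x : ℝ, r * (n : ℝ) ^ (-(1 : ℝ) / d) ≤ x →
      f x / f (x + √2 * R * (n : ℝ) ^ (-(1 : ℝ) / d)) ≤ C₀)
    -- the approximating configurations
    (X' : (n : ℕ) → Fin n → EuclideanSpace ℝ (Fin p))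
    (hX' : ∀ n, 2 ≤ n → PointConfig.IsAdmissible d Ω r R n (X' n))
    (ν' : FiniteMeasure (EuclideanSpace ℝ (Fin p)))
    (hν' : Tendsto (fun n => PointConfig.empirical n (X' n)) atTop (𝓝 ν'))
    (ρstar : EuclideanSpace ℝ (Fin p) → ℝ)
    (hρstar : PointConfig.IsExtremalDensity d Ω f ρplus ρminus ρstar)
    (hν'ρ : PointConfig.HasDensity d Ω ν' ρstar)
    -- the optimal configurations
    (X : (n : ℕ) → Fin n → EuclideanSpace ℝ (Fin p))
    (hX : ∀ n, 2 ≤ n → PointConfig.IsOptimalConfig d Ω r R f n (X n))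
    -- a weak-* limit of their empirical measures
    (ν : FiniteMeasure (EuclideanSpace ℝ (Fin p)))
    (hν : ∃ φ : ℕ → ℕ, StrictMono φ ∧
      Tendsto (fun m => PointConfig.empirical (φ m) (X (φ m))) atTop (𝓝 ν)) :
    ∃ ρ : EuclideanSpace ℝ (Fin p) → ℝ,
      PointConfig.IsExtremalDensity d Ω f ρplus ρminus ρ ∧ PointConfig.HasDensity d Ω ν ρ := by

  have hfinite : IsFiniteMeasure (PointConfig.surf d Ω) := ⟨hΩfin⟩
  obtain ⟨c, hc, s₀, hs₀, hA⟩ := PointConfig.exists_le_surf_ball hd hdp hΩc hΩman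
  obtain ⟨C₀, hC⟩ := hC
  obtain ⟨φ, hφ, hνφ⟩ := hν
  -- Strict monotonicity gives φ (m + 2) ≥ 2, the range in which the configurations are assumed
  -- admissible or optimal.
  set ψ : ℕ → ℕ := fun m => φ (m + 2) with hψdef
  have hψ2 : ∀ m, 2 ≤ ψ m := fun m => (Nat.le_add_left 2 m).trans (hφ.id_le _)
  have hψ1 : ∀ m, 1 ≤ ψ m := fun m => one_le_two.trans (hψ2 m)
  have hψ : Tendsto ψ atTop atTop := hφ.tendsto_atTop.comp (tendsto_add_atTop_nat 2)
  have hνψ : Tendsto (fun m => PointConfig.empirical (ψ m) (X (ψ m))) atTop (𝓝 ν) :=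
    hνφ.comp (tendsto_add_atTop_nat 2)
  have hνψ' : Tendsto (fun m => PointConfig.empirical (ψ m) (X' (ψ m))) atTop (𝓝 ν') :=
    hν'.comp hψ
  have hXψ : ∀ m, PointConfig.IsAdmissible d Ω r R (ψ m) (X (ψ m)) := fun m => (hX _ (hψ2 m)).1
  have hρplus0 : 0 < ρplus :=
    (inv_pos.2 (ENNReal.toReal_pos hΩpos.ne' hΩfin.ne)).trans_le hρplus
  have hνprob : IsProbabilityMeasure (ν : Measure (EuclideanSpace ℝ (Fin p))) := by
    obtain ⟨-, Q, -, hQ, -⟩ := PointConfig.exists_tendsto_probabilityMeasure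
      (fun m => PointConfig.isProbabilityMeasure_empirical (hψ1 m) (X (ψ m))) hνψ
    rw [← hQ]; infer_instance
  have hupper : (ν : Measure (EuclideanSpace ℝ (Fin p))) ≤
      ENNReal.ofReal ρplus • PointConfig.surf d Ω := by
    have : IsFiniteMeasure (ENNReal.ofReal ρplus • PointConfig.surf d Ω) :=
      Measure.smul_finite _ ENNReal.ofReal_ne_top
    refine PointConfig.measure_le_of_isCompact_isOpen fun K O hK hO hKO => ?_
    obtain ⟨V, hV, hKV, hVO, hVf⟩ :=
      PointConfig.exists_isOpen_null_frontier (PointConfig.surf d Ω) hK hO hKO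
    calc _ ≤ _ := measure_mono hKV
      _ ≤ _ := PointConfig.limit_open_le hd hΩc hΩeuc hr hρplus0 hpack hψ hψ1 hXψ hνψ hV hVf
      _ ≤ _ := by
        rw [Measure.smul_apply, smul_eq_mul]
        gcongr
        exact subset_closure.trans hVO
  have hlower : ENNReal.ofReal ρminus • PointConfig.surf d Ω ≤
      (ν : Measure (EuclideanSpace ℝ (Fin p))) := by
    have : IsFiniteMeasure (ENNReal.ofReal ρminus • PointConfig.surf d Ω) :=
      Measure.smul_finite _ ENNReal.ofReal_ne_top
    refine PointConfig.measure_le_of_isCompact_isOpen fun K O hK hO hKO => ?_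
    obtain ⟨V, hV, hKV, hVO, hVf⟩ :=
      PointConfig.exists_isOpen_null_frontier (PointConfig.surf d Ω) hK hO hKO
    calc _ ≤ ENNReal.ofReal ρminus * PointConfig.surf d Ω V := by
          rw [Measure.smul_apply, smul_eq_mul]
          gcongr
      _ ≤ _ := PointConfig.le_limit_closure hd hΩc hΩeuc hc hs₀ hA hR hρpos hcover hψ hψ1 hXψ hνψ
          hV hVf
      _ ≤ _ := measure_mono hVO
  obtain ⟨ρ, hρmem, -, hρint, hρbd, hνρ⟩ :=
    PointConfig.exists_density_of_le_of_le hρplus0.le hlower hupper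
  have hadm : PointConfig.IsAdmissibleDensity d Ω ρplus ρminus ρ := ⟨hρmem, hρint, hρbd⟩
  have hdens : PointConfig.HasDensity d Ω ν ρ := hνρ
  refine ⟨ρ, ⟨hadm, fun σ hσ => (hρstar.2 σ hσ).trans ?_⟩, hdens⟩
  have hX2 := (hX 2 le_rfl).1
  have h01 : (0 : Fin 2) ≠ 1 := by decide
  -- Positivity of k on Ω and monotonicity give f > 0 on (0, D] for any distance D realized in Ω.
  -- This is needed because division by zero yields 0, so the ratio bound is empty where its
  -- denominator vanishes.
  set D : ℝ := dist (X 2 0) (X 2 1) with hDdef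
  have hDpos : 0 < D := hX2.dist_pos hr one_le_two h01
  have hfD : ∀ t, 0 < t → t ≤ D → 0 < f t := fun t ht htD =>
    (hfpos _ (hX2.1 0) _ (hX2.1 1) (dist_pos.1 hDpos)).trans_le (hf.antitoneOn ht hDpos htD)
  -- The first bound makes balls of radius κ n^(-1/d) about the points disjoint; the second keeps
  -- the change in distance within the shift √2 R n^(-1/d) of the ratio condition.
  set κ : ℝ := min (r / 2) (√2 * R / 2) with hκdef
  have hκ : 0 < κ := lt_min (by positivity) (by positivity)
  have hκr : 2 * κ ≤ r := by linarith [min_le_left (r / 2) (√2 * R / 2)]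
  have hκR : 2 * κ ≤ √2 * R := by linarith [min_le_right (r / 2) (√2 * R / 2)]
  have hCtop : ENNReal.ofReal C₀ * (ENNReal.ofReal (c * κ ^ d))⁻¹ ^ 2 ≠ ⊤ :=
    ENNReal.mul_ne_top ENNReal.ofReal_ne_top
      (ENNReal.pow_ne_top (ENNReal.inv_ne_top.2 (by simp; positivity)))
  have hac : ∀ {μ : FiniteMeasure (EuclideanSpace ℝ (Fin p))} {τ : EuclideanSpace ℝ (Fin p) → ℝ},
      PointConfig.HasDensity d Ω μ τ →
        (μ : Measure (EuclideanSpace ℝ (Fin p))) ≪ PointConfig.surf d Ω := fun {μ τ} h => by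
    rw [show (μ : Measure (EuclideanSpace ℝ (Fin p))) = _ from h]
    exact withDensity_absolutelyContinuous _ _
  have hle := PointConfig.lintegral_kernel_le hd hf hfint.lintegral_lt_top.ne hCtop hDpos
    (hac hdens) (hac hν'ρ) fun ε hε hεD =>
      PointConfig.lintegral_cutKernel_le hd hc hs₀ hA hf hr hκ hκr hκR hε hεD hC hfD hψ hψ1
        (fun m => hX _ (hψ2 m)) (fun m => hX' _ (hψ2 m)) hνψ hνψ'
  obtain ⟨h₁, -⟩ := PointConfig.densityEnergy_eq hd hf hfint hρpos hρstar.1 hν'ρ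
  obtain ⟨h₂, h₃⟩ := PointConfig.densityEnergy_eq hd hf hfint hρpos hadm hdens
  rw [h₁, h₂]
  -- Finiteness of the larger energy matters: `toReal` sends ⊤ to 0.
  have := ENNReal.toReal_mono h₃ hle
  linarith
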